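/- **Definitions.** A *causal influence diagram* (CID) is a finite directed acyclic graph $\mathcal G$ whose vertex set $V$ is partitioned into structure nodes, decision nodes and utility nodes, where utility nodes have no children. It is *single-decision* if it has exactly one decision node $D$. Write $\mathrm{Pa}_v$ for the set of parents of $v$ and $\mathrm{Fa}_v=\{v\}\cup \mathrm{Pa}_v$; directed paths may have length zero. A *structural causal influence model* (SCIM) compatible with $\mathcal G$ consists of: a finite nonempty domain $\mathrm{dom}(v)$ for every node $v$, with $\mathrm{dom}(U)\subset\mathbb R$ for each utility node $U$; a finite-domain exogenous variable $\mathcal E^v$ for every node $v$; a structural function $f_v:\mathrm{dom}(\mathrm{Pa}_v)\times\mathrm{dom}(\mathcal E^v)\to\mathrm{dom}(v)$ for every structure or utility node $v$; and a probability distribution $P$ of $(\mathcal E^v)_{v\in V}$ under which the $\mathcal E^v$ are mutually independent. A *policy* is a function $\pi:\mathrm{dom}(\mathrm{Pa}_D)\times\mathrm{dom}(\mathcal E^D)\to\mathrm{dom}(D)$. With $\pi$ as structural function of $D$, each setting $\varepsilon$ of the exogenous variables determines a value $v(\varepsilon)$ of every node $v$ by recursion along the graph. The policy $\pi$ is *optimal*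 if it maximizes the expectation, over $\varepsilon\sim P$, of the sum of all utility nodes. For $x\in\mathrm{dom}(X)$, $D_x(\varepsilon)$ denotes the value of $D$ after the structural function of $X$ has been replaced by the constant $x$. A SCIM has a *response incentive* on a node $X\neq D$ if for every optimal policy there are $x\in\mathrm{dom}(X)$ and a setting $\varepsilon$ of the exogenous variables with $D_x(\varepsilon)\ne D(\varepsilon)$. The CID $\mathcal G$ is *compatible with* a response incentive on $X$ if some SCIM compatible with $\mathcal G$ has one. An undirected path (without repeated nodes) is *blocked* by a set $Z$ of nodes if it contains a chain $a\to b\to c$ (traversed in either direction) or a fork $a\leftarrow b\to c$ with $b\in Z$, or a collider $a\to b\leftarrow c$ such that neither $b$ nor any descendant of $b$ is in $Z$. Two nodes are *d-connected given $Z$* if some undirected path between them is not blocked by $Z$. **Theorem (Response Incentive Graphical Criterion).** Let $\mathcal G$ be a single-decision causal influence diagram with decision node $D$, and let $X\ne D$ be a node. Then $\mathcal G$ is compatible with a response incentive on $X$ if and only if there are a parent $W\in\mathrm{Pa}_D$ and a utility node $U$ such that 1. there is a directed path from $X$ to $W$, 2. there is a directed path from $D$ to $U$, and 3. $W$ is d-connected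 to $U$ given $\mathrm{Fa}_D\setminus\{W\}$. -/

import Mathlib

/-- A directed acyclic graph on the vertex set `V`; `G.Adj v w` is the edge `v → w`. -/
structure DAG (V : Type*) where
  /-- The edge relation. -/
  Adj : V → V → Prop
  acyclic : ∀ v, ¬ Relation.TransGen Adj v v

namespace DAG

variable {V : Type*} (G : DAG V)

/-- The parents of a node. -/
def parents (v : V) : Set V := {w | G.Adj w v}

/-- The family of a node: the node together with its parents. -/
def family (v : V) : Set V := insert v (G.parents v)

/-- There is a directed path, of length at least zero, from `v` to `w`. -/
def HasDirectedPath (v w : V) : Prop := Relation.ReflTransGen G.Adj v w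

/-- `w` is a proper descendant of `v`: there is a directed path of positive length. -/
def IsDescendant (v w : V) : Prop := Relation.TransGen G.Adj v w

/-- The underlying undirected graph. -/
def skeleton : SimpleGraph V := SimpleGraph.fromRel G.Adj

/-- The walk `p` is blocked (d-separated) by `Z`: it contains three consecutive nodes `a, b, c`
which form a chain (in either direction) or a fork with `b ∈ Z`, or which form a collider
such that neither `b` nor any descendant of `b` is in `Z`. -/
def Blocked (Z : Set V) {x y : V} (p : G.skeleton.Walk x y) : Prop :=
  ∃ i : ℕ, i + 2 ≤ p.length ∧ ∃ a b c : V,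
    a = p.getVert i ∧ b = p.getVert (i + 1) ∧ c = p.getVert (i + 2) ∧
    ((((G.Adj a b ∧ G.Adj b c) ∨ (G.Adj c b ∧ G.Adj b a) ∨ (G.Adj b a ∧ G.Adj b c)) ∧ b ∈ Z) ∨
      ((G.Adj a b ∧ G.Adj c b) ∧ b ∉ Z ∧ ∀ d, G.IsDescendant b d → d ∉ Z))

/-- `Z` d-separates `A` from `B`: it blocks every undirected path (that is, every walk without
repeated nodes) from a node of `A` to a node of `B`. -/
def DSep (A B Z : Set V) : Prop :=
  ∀ x ∈ A, ∀ y ∈ B, ∀ p : G.skeleton.Walk x y, p.IsPath → G.Blocked Z p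

/-- Sets that are not d-separated are d-connected. -/
def DConn (A B Z : Set V) : Prop := ¬ G.DSep A B Z

theorem wellFounded_adj [Finite V] : WellFounded G.Adj := by
  have : IsTrans V (Relation.TransGen G.Adj) := ⟨fun _ _ _ h h' => h.trans h'⟩
  have : Std.Irrefl (Relation.TransGen G.Adj) := ⟨G.acyclic⟩
  exact Subrelation.wf (fun h => Relation.TransGen.single h)
    (Finite.wellFounded_of_trans_of_irrefl (Relation.TransGen G.Adj))

end DAG

/-- A probability distribution on a product of exogenous variables makes the coordinates mutually
independent: the joint probability mass function is the product of its marginals. -/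
def MutuallyIndependent {V : Type*} [Fintype V] {Exo : V → Type} (P : PMF (∀ v, Exo v)) : Prop :=
  ∀ e : ∀ v, Exo v, P e = ∏ v, (P.map (fun e' => e' v)) (e v)

/-- A structural causal model (with independent errors) on the directed acyclic graph `G`. -/
structure SCM {V : Type*} [Fintype V] (G : DAG V) where
  /-- The domains of the structural variables. -/
  Dom : V → Type
  [finite_dom : ∀ v, Finite (Dom v)]
  [nonempty_dom : ∀ v, Nonempty (Dom v)]
  /-- The domains of the exogenous variables, one for each node. -/
  Exo : V → Type
  [fintype_exo : ∀ v, Fintype (Exo v)]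
  /-- The structural functions. -/
  f : ∀ v, (∀ w : G.parents v, Dom w) → Exo v → Dom v
  /-- The joint distribution of the exogenous variables. -/
  P : PMF (∀ v, Exo v)
  indep : MutuallyIndependent P

namespace SCM

variable {V : Type*} [Fintype V] {G : DAG V}

/-- The values of all variables at the setting `e` of the exogenous variables, by recursive
application of the structural functions. -/
noncomputable def eval (M : SCM G) (e : ∀ v, M.Exo v) : ∀ v, M.Dom v :=
  G.wellFounded_adj.fix (C := M.Dom) fun v ih => M.f v (fun w => ih w.1 w.2) (e v)

theorem eval_eq (M : SCM G) (e : ∀ v, M.Exo v) (v : V) :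
    M.eval e v = M.f v (fun w => M.eval e w.1) (e v) :=
  G.wellFounded_adj.fix_eq _ v

/-- The submodel given by the intervention `Do(X = x)`: the structural function of `X` is replaced
by the constant function with value `x`. -/
@[reducible] def intervene [DecidableEq V] (M : SCM G) (X : V) (x : M.Dom X) : SCM G :=
  { M with f := Function.update M.f X (fun _ _ => x) }

theorem intervene_f_self [DecidableEq V] (M : SCM G) (X : V) (x : M.Dom X) :
    (M.intervene X x).f X = fun _ _ => x :=
  Function.update_self X (fun _ _ => x) M.f

theorem intervene_f_of_ne [DecidableEq V] (M : SCM G) (X : V) (x : M.Dom X) (v : V) (h : v ≠ X) :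
    (M.intervene X x).f v = M.f v :=
  Function.update_of_ne h (fun _ _ => x) M.f

/-- The potential response `Y_x(e)`: the value of `Y` in the submodel for `Do(X = x)`. -/
noncomputable def potentialResponse [DecidableEq V] (M : SCM G) (X : V) (x : M.Dom X)
    (e : ∀ v, M.Exo v) (Y : V) : M.Dom Y :=
  (M.intervene X x).eval e Y

end SCM

/-- The three types of nodes of a causal influence diagram. -/
inductive NodeKind where
  /-- A structure node. -/
  | chance
  /-- A decision node. -/
  | decision
  /-- A utility node. -/
  | utility
  deriving DecidableEq

/-- A causal influence diagram: a directed acyclic graph whose vertex set is partitioned into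
structure, decision and utility nodes, such that utility nodes have no children. -/
structure CID (V : Type*) extends DAG V where
  /-- The partition of the nodes. -/
  kind : V → NodeKind
  utility_no_children : ∀ u v, kind u = NodeKind.utility → ¬ Adj u v

/-- `D` is the one and only decision node. -/
def CID.IsSingleDecision {V : Type*} (C : CID V) (D : V) : Prop :=
  ∀ v, C.kind v = NodeKind.decision ↔ v = D

/-- A structural causal influence model compatible with the causal influence diagram `C`. Decision
nodes have no structural function, but they do have an exogenous variable. -/
structure SCIM {V : Type*} [Fintype V] (C : CID V) where
  /-- The domains of the variables. -/
  Dom : V → Type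
  [finite_dom : ∀ v, Finite (Dom v)]
  [nonempty_dom : ∀ v, Nonempty (Dom v)]
  /-- The domains of utility variables are subsets of the real line. -/
  util : ∀ u, C.kind u = NodeKind.utility → (Dom u ↪ ℝ)
  /-- The domains of the exogenous variables, one for each node. -/
  Exo : V → Type
  [fintype_exo : ∀ v, Fintype (Exo v)]
  /-- The structural functions of the structure nodes and of the utility nodes. -/
  f : ∀ v, C.kind v ≠ NodeKind.decision → (∀ w : C.parents v, Dom w) → Exo v → Dom v
  /-- The joint distribution of the exogenous variables. -/
  P : PMF (∀ v, Exo v)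
  indep : MutuallyIndependent P

attribute [instance] SCIM.fintype_exo SCIM.finite_dom SCIM.nonempty_dom

namespace SCIM

variable {V : Type*} [Fintype V] {C : CID V}

/-- A policy for the decision `D`: a function of the parents and of the exogenous variable
of `D`. -/
def Policy (M : SCIM C) (D : V) : Type _ := (∀ w : C.parents D, M.Dom w) → M.Exo D → M.Dom D

/-- The structural causal model obtained from a single-decision model by using the policy as the
structural function of the decision. -/
@[reducible] noncomputable def withPolicy (M : SCIM C) {D : V} (hD : C.IsSingleDecision D) (π : M.Policy D) :
    SCM C.toDAG where
  Dom := M.Dom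
  finite_dom := M.finite_dom
  nonempty_dom := M.nonempty_dom
  Exo := M.Exo
  fintype_exo := M.fintype_exo
  f v := if h : C.kind v = NodeKind.decision then
      Eq.rec (motive := fun v _ => (∀ w : C.parents v, M.Dom w) → M.Exo v → M.Dom v)
        π ((hD v).1 h).symm
    else M.f v h
  P := M.P
  indep := M.indep

theorem withPolicy_f_decision (M : SCIM C) {D : V} (hD : C.IsSingleDecision D) (π : M.Policy D) :
    (M.withPolicy hD π).f D = π := by
  have h : C.kind D = NodeKind.decision := (hD D).2 rfl
  exact dif_pos h

theorem withPolicy_f_of_ne (M : SCIM C) {D : V} (hD : C.IsSingleDecision D) (π : M.Policy D)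
    (v : V) (h : C.kind v ≠ NodeKind.decision) : (M.withPolicy hD π).f v = M.f v h := by
  exact dif_neg h

/-- The sum of the utility variables, at the setting `e` of the exogenous variables, under the
policy `π`. -/
noncomputable def totalUtility (M : SCIM C) {D : V} (hD : C.IsSingleDecision D) (π : M.Policy D)
    (e : ∀ v, M.Exo v) : ℝ :=
  ∑ u : {u : V // C.kind u = NodeKind.utility}, M.util u.1 u.2 ((M.withPolicy hD π).eval e u.1)

/-- The expected total utility of the policy `π`. -/
noncomputable def expectedUtility [DecidableEq V] (M : SCIM C) {D : V} (hD : C.IsSingleDecision D)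
    (π : M.Policy D) : ℝ :=
  ∑ e : ∀ v, M.Exo v, (M.P e).toReal * M.totalUtility hD π e

/-- A policy is optimal if it maximizes the expected total utility. -/
def IsOptimal [DecidableEq V] (M : SCIM C) {D : V} (hD : C.IsSingleDecision D) (π : M.Policy D) : Prop :=
  ∀ π' : M.Policy D, M.expectedUtility hD π' ≤ M.expectedUtility hD π

/-- There is a response incentive on `X`: for every optimal policy there are an intervention
`Do(X = x)` and a setting `e` of the exogenous variables with `D_x(e) ≠ D(e)`. -/
def HasResponseIncentive [DecidableEq V] (M : SCIM C) {D : V} (hD : C.IsSingleDecision D) (X : V) : Prop :=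
  ∀ π : M.Policy D, M.IsOptimal hD π →
    ∃ (x : M.Dom X) (e : ∀ v, M.Exo v),
      (M.withPolicy hD π).potentialResponse X x e D ≠ (M.withPolicy hD π).eval e D

end SCIM

/-- The diagram is compatible with a response incentive on `X`: some compatible model has one. -/
def CID.CompatibleWithResponseIncentive {V : Type*} [Fintype V] [DecidableEq V] (C : CID V) {D : V}
    (hD : C.IsSingleDecision D) (X : V) : Prop :=
  ∃ M : SCIM C, M.HasResponseIncentive hD X

/-! Necessity. Let `N` be the set of parents of `D` that are d-separated, given the rest of the
family, from every utility node that `D` can influence. Some optimal policy ignores `N`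
(`SCIM.exists_isOptimal_of_dSep`). If the criterion fails, every parent of `D` that descends from
`X` lies in `N`, so under this policy no intervention on `X` moves `D`. The policy maximizes the
utility conditioned on the parents outside `N` only. It is optimal because each influenced utility
is conditionally independent of what else the policy sees. This independence is proved by an
exchange: `DAG.exists_separating_set` cuts the relevant ancestors into two sides, and two noise
settings trade their noise on one side (`SCIM.val_mix`, `SCIM.sum_seeing_mul_sum_agreeing`).

Sufficiency. Random signs travel along the active path from `W` to `U`; a collider multiplies the
signs of its neighbours and, being an ancestor of `D`, reports the product to `D`. The sign of `W`
times those of the colliders telescopes to the last sign before `U` (`tail_eq_prod`), and `U`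
rewards guessing that sign, so every optimal policy always guesses it (`match_of_isOptimal`). A
suitable value of `X` replaces the sign of `W` by `0`. The parents of `D` then do not notice when
all noise except that of `D` is flipped, whereas the last sign changes. Hence the masking must alter
the decision at one of the two settings (`hasResponseIncentive`). -/

namespace DAG

/-! ### Active walks and d-connection -/

variable {V : Type*} (G : DAG V)

/-- The middle node of the triple `a, b, c` does not block it, given `Z`. -/
def OpenAt (Z : Set V) (a b c : V) : Prop :=
  ((G.Adj b a ∨ G.Adj b c) → b ∉ Z) ∧
    (G.Adj a b → G.Adj c b → ∃ d ∈ Z, G.HasDirectedPath b d)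

/-- The first `n + 1` terms of the sequence `s` form a walk in the skeleton that is not blocked
by `Z`. -/
structure IsActive (Z : Set V) (n : ℕ) (s : ℕ → V) : Prop where
  adj : ∀ i < n, G.Adj (s i) (s (i + 1)) ∨ G.Adj (s (i + 1)) (s i)
  isOpen : ∀ i, i + 2 ≤ n → G.OpenAt Z (s i) (s (i + 1)) (s (i + 2))

variable {G}

theorem Adj.asymm {a b : V} (h : G.Adj a b) : ¬ G.Adj b a := fun h' =>
  G.acyclic a (.tail (.single h) h')

theorem Adj.ne {a b : V} (h : G.Adj a b) : a ≠ b := by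
  rintro rfl
  exact h.asymm h

theorem HasDirectedPath.not_adj {a b : V} (h : G.HasDirectedPath a b) : ¬ G.Adj b a := fun h' =>
  G.acyclic a (.tail' h h')

theorem skeleton_adj {a b : V} : G.skeleton.Adj a b ↔ G.Adj a b ∨ G.Adj b a := by
  rw [skeleton, SimpleGraph.fromRel_adj]
  refine ⟨fun h => h.2, fun h => ⟨?_, h⟩⟩
  rcases h with h | h
  · exact h.ne
  · exact h.ne.symm

theorem openAt_iff {Z : Set V} {a b c : V} (hab : G.Adj a b ∨ G.Adj b a)
    (hbc : G.Adj b c ∨ G.Adj c b) :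
    G.OpenAt Z a b c ↔
      ¬ ((((G.Adj a b ∧ G.Adj b c) ∨ (G.Adj c b ∧ G.Adj b a) ∨ (G.Adj b a ∧ G.Adj b c)) ∧ b ∈ Z) ∨
      ((G.Adj a b ∧ G.Adj c b) ∧ b ∉ Z ∧ ∀ d, G.IsDescendant b d → d ∉ Z)) := by
  have h1 : (∃ d ∈ Z, G.HasDirectedPath b d) ↔ ¬ (b ∉ Z ∧ ∀ d, G.IsDescendant b d → d ∉ Z) := by
    simp only [HasDirectedPath, IsDescendant, Relation.reflTransGen_iff_eq_or_transGen]
    constructor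
    · rintro ⟨d, hd, rfl | h⟩ ⟨h1, h2⟩
      · exact h1 hd
      · exact h2 d h hd
    · intro h
      by_contra! h'
      exact h ⟨fun hb => (h' b hb).1 rfl, fun d hd hz => (h' d hz).2 hd⟩
  rw [OpenAt, h1]
  tauto

theorem not_blocked_iff {Z : Set V} {x y : V} (p : G.skeleton.Walk x y) :
    ¬ G.Blocked Z p ↔ G.IsActive Z p.length p.getVert := by
  have hadj : ∀ i < p.length, G.Adj (p.getVert i) (p.getVert (i + 1)) ∨
      G.Adj (p.getVert (i + 1)) (p.getVert i) := fun i hi =>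
    skeleton_adj.1 (p.adj_getVert_succ hi)
  constructor
  · intro h
    refine ⟨hadj, fun i hi => ?_⟩
    rw [openAt_iff (hadj i (by omega)) (hadj (i + 1) (by omega))]
    exact fun h' => h ⟨i, hi, _, _, _, rfl, rfl, rfl, h'⟩
  · rintro h ⟨i, hi, _, _, _, rfl, rfl, rfl, h'⟩
    exact (openAt_iff (hadj i (by omega)) (hadj (i + 1) (by omega))).1 (h.isOpen i hi) h'

theorem exists_walk_of_adj (n : ℕ) : ∀ (s : ℕ → V)
    (_ : ∀ i < n, G.Adj (s i) (s (i + 1)) ∨ G.Adj (s (i + 1)) (s i)),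
    ∃ p : G.skeleton.Walk (s 0) (s n), p.length = n ∧ ∀ k ≤ n, p.getVert k = s k := by
  induction n with
  | zero =>
    intro s _
    refine ⟨.nil, rfl, fun k hk => ?_⟩
    obtain rfl : k = 0 := by omega
    rfl
  | succ n ih =>
    intro s h
    obtain ⟨p, hp, hv⟩ := ih (fun k => s (k + 1)) (fun i hi => h (i + 1) (by omega))
    refine ⟨.cons (skeleton_adj.2 (h 0 (by omega))) p, by simp [hp], fun k hk => ?_⟩
    cases k with
    | zero => rfl
    | succ k => simpa using hv k (by omega)

/-- Sequences replace walks so that cutting and splicing become index arithmetic. -/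
theorem dConn_singleton_iff {Z : Set V} {x y : V} :
    G.DConn {x} {y} Z ↔
      ∃ (n : ℕ) (s : ℕ → V), s 0 = x ∧ s n = y ∧ G.IsActive Z n s ∧ Set.InjOn s {k | k ≤ n} := by
  simp only [DConn, DSep, Set.mem_singleton_iff, forall_eq, not_forall]
  constructor
  · rintro ⟨p, hp, h⟩
    exact ⟨p.length, p.getVert, by simp, by simp, (not_blocked_iff p).1 h, hp.getVert_injOn⟩
  · rintro ⟨n, s, rfl, rfl, h, hinj⟩
    obtain ⟨p, hp, hv⟩ := exists_walk_of_adj n s h.adj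
    refine ⟨p, ?_, ?_⟩
    · rw [← SimpleGraph.Walk.IsPath.getVert_injOn_iff]
      rw [hp]
      intro a ha b hb hab
      exact hinj ha hb (by rw [← hv a ha, ← hv b hb, hab])
    · rw [not_blocked_iff, hp]
      refine ⟨fun i hi => ?_, fun i hi => ?_⟩
      · rw [hv i (by omega), hv (i + 1) (by omega)]
        exact h.adj i hi
      · rw [hv i (by omega), hv (i + 1) (by omega), hv (i + 2) (by omega)]
        exact h.isOpen i hi

namespace IsActive

variable {Z : Set V} {n : ℕ} {s : ℕ → V}

theorem drop (h : G.IsActive Z n s) (j : ℕ) : G.IsActive Z (n - j) (fun k => s (k + j)) := by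
  refine ⟨fun i hi => ?_, fun i hi => ?_⟩
  · have := h.adj (i + j) (by omega)
    rwa [show i + j + 1 = i + 1 + j by omega] at this
  · have := h.isOpen (i + j) (by omega)
    rwa [show i + j + 1 = i + 1 + j by omega, show i + j + 2 = i + 2 + j by omega] at this

theorem cons (h : G.IsActive Z n s) {a : V} (ha : G.Adj a (s 0) ∨ G.Adj (s 0) a)
    (ho : 1 ≤ n → G.OpenAt Z a (s 0) (s 1)) :
    G.IsActive Z (n + 1) (fun k => Nat.casesOn k a s) := by
  refine ⟨fun i hi => ?_, fun i hi => ?_⟩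
  · cases i with
    | zero => exact ha
    | succ i => exact h.adj i (by omega)
  · cases i with
    | zero => exact ho (by omega)
    | succ i => exact h.isOpen i (by omega)

/-- If the walk leaves `s i` in the direction of an edge and returns to it, then `s i` is an
ancestor of a collider and hence of `Z`. -/
theorem exists_mem_of_eq (h : G.IsActive Z n s) {i j : ℕ} (hij : i < j) (hj : j ≤ n)
    (he : s i = s j) (h0 : G.Adj (s i) (s (i + 1))) : ∃ d ∈ Z, G.HasDirectedPath (s i) d := by
  by_contra hno
  -- The first backward edge would create an open collider below `s i`, hence a descendant in `Z`.
  -- Without one the walk stays directed, and its return to `s i` closes a cycle.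
  have key : ∀ k, i + k + 1 ≤ j →
      Relation.TransGen G.Adj (s i) (s (i + k + 1)) ∧ G.Adj (s (i + k)) (s (i + k + 1)) := by
    intro k
    induction k with
    | zero => exact fun _ => ⟨.single h0, h0⟩
    | succ k ih =>
      intro hk
      obtain ⟨h1, h2⟩ := ih (by omega)
      rcases h.adj (i + k + 1) (by omega) with h3 | h3
      · exact ⟨.tail h1 h3, h3⟩
      · obtain ⟨d, hd, hp⟩ := (h.isOpen (i + k) (by omega)).2 h2 h3
        exact absurd ⟨d, hd, h1.to_reflTransGen.trans hp⟩ hno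
  obtain ⟨h1, -⟩ := key (j - i - 1) (by omega)
  rw [show i + (j - i - 1) + 1 = j by omega, ← he] at h1
  exact G.acyclic _ h1

/-- Cutting out a loop of an active walk leaves an active walk. -/
theorem splice (h : G.IsActive Z n s) {i j : ℕ} (hij : i < j) (hj : j ≤ n) (he : s i = s j) :
    G.IsActive Z (n - (j - i)) (fun k => if k ≤ i then s k else s (k + (j - i))) := by
  refine ⟨fun k hk => ?_, fun k hk => ?_⟩
  · rcases lt_trichotomy k i with hki | rfl | hki
    · simpa [hki.le, Nat.succ_le_of_lt hki] using h.adj k (by omega)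
    · have := h.adj j (by omega)
      rw [← he] at this
      simpa [show k + 1 + (j - k) = j + 1 by omega] using this
    · have := h.adj (k + (j - i)) (by omega)
      rw [show k + (j - i) + 1 = k + 1 + (j - i) by omega] at this
      simpa [show ¬ k ≤ i by omega, show ¬ k + 1 ≤ i by omega] using this
  · rcases lt_trichotomy (k + 1) i with hki | hki | hki
    · simpa [show k ≤ i by omega, show k + 1 ≤ i by omega, show k + 2 ≤ i by omega]
        using h.isOpen k (by omega)
    · have e1 : k + 2 + (j - i) = j + 1 := by omega
      simp only [show k ≤ i by omega, show k + 1 ≤ i by omega, show ¬ k + 2 ≤ i by omega, if_true,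
        if_false, e1]
      subst hki
      refine ⟨?_, fun h1 h2 => ?_⟩
      · rintro (h1 | h1)
        · exact (h.isOpen k (by omega)).1 (Or.inl h1)
        · rw [he] at h1 ⊢
          have := (h.isOpen (j - 1) (by omega)).1
          rw [show j - 1 + 1 = j by omega, show j - 1 + 2 = j + 1 by omega] at this
          exact this (Or.inr h1)
      -- The junction may be a collider only after the cut. If the loop left it forwards, the loop
      -- itself supplies a descendant in `Z`; otherwise it was already a collider at its first
      -- visit.
      · rcases h.adj (k + 1) (by omega) with h3 | h3
        · exact h.exists_mem_of_eq hij hj he h3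
        · exact (h.isOpen k (by omega)).2 h1 h3
    · rcases Nat.lt_or_ge i k with hk' | hk'
      · have := h.isOpen (k + (j - i)) (by omega)
        rw [show k + (j - i) + 1 = k + 1 + (j - i) by omega,
          show k + (j - i) + 2 = k + 2 + (j - i) by omega] at this
        simpa [show ¬ k ≤ i by omega, show ¬ k + 1 ≤ i by omega, show ¬ k + 2 ≤ i by omega]
          using this
      · obtain rfl : k = i := by omega
        have := h.isOpen j (by omega)
        rw [← he] at this
        simpa [show k + 1 + (j - k) = j + 1 by omega, show k + 2 + (j - k) = j + 2 by omega]
          using this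

/-- An active walk from `N` to `u` can be shortened to an active path that meets `N` only in its
first node. -/
theorem exists_injOn (h : G.IsActive Z n s) {N : Set V} (h0 : s 0 ∈ N) :
    ∃ (m : ℕ) (t : ℕ → V), t 0 ∈ N ∧ t m = s n ∧ G.IsActive Z m t ∧ Set.InjOn t {k | k ≤ m} ∧
      ∀ k, 0 < k → k ≤ m → t k ∉ N := by
  classical
  have hex : ∃ (m : ℕ) (t : ℕ → V), t 0 ∈ N ∧ t m = s n ∧ G.IsActive Z m t := ⟨n, s, h0, rfl, h⟩
  -- In a walk of minimal length, a repeated node could be spliced out and a later visit to `N`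
  -- could serve as the start.
  obtain ⟨t, ht0, htm, ht⟩ := Nat.find_spec hex
  have hmin := fun m (hm : m < Nat.find hex) => Nat.find_min hex hm
  generalize Nat.find hex = m at *
  have hinj : ∀ i j, i < j → j ≤ m → t i ≠ t j := by
    intro i j hij hj he
    refine hmin (m - (j - i)) (by omega) ⟨_, ?_, ?_, ht.splice hij hj he⟩
    · simpa using ht0
    · by_cases hjm : j = m
      · subst hjm
        simpa [show j - (j - i) = i by omega, he] using htm
      · simpa [show ¬ m - (j - i) ≤ i by omega, show m - (j - i) + (j - i) = m by omega] using htm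
  refine ⟨m, t, ht0, htm, ht, fun a ha b hb hab => ?_, fun k hk hkm hkN => ?_⟩
  · rcases lt_trichotomy a b with hlt | he | hlt
    · exact absurd hab (hinj a b hlt hb)
    · exact he
    · exact absurd hab.symm (hinj b a hlt ha)
  · exact hmin (m - k) (by omega) ⟨_, by simpa using hkN,
      by simpa [show m - k + k = m by omega] using htm, ht.drop k⟩

end IsActive

/-! ### Directed paths and separating sets -/

/-- A directed path has no colliders, and its nodes descend from `w`, hence avoid `Z`. The direction
of the first edge is recorded so that the walk can be prolonged at `w`. -/
theorem exists_active_of_directedPath {Z : Set V} {w u : V} (h : G.HasDirectedPath w u)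
    (hw : ¬ ∃ d ∈ Z, G.HasDirectedPath w d) :
    ∃ (n : ℕ) (s : ℕ → V), s 0 = w ∧ s n = u ∧ G.IsActive Z n s ∧
      (1 ≤ n → G.Adj (s 0) (s 1)) := by
  induction h using Relation.ReflTransGen.head_induction_on with
  | refl => exact ⟨0, fun _ => u, rfl, rfl, ⟨by omega, by omega⟩, by omega⟩
  | @head a c hac hcu ih =>
    obtain ⟨n, s, rfl, rfl, hs, h1⟩ := ih fun ⟨d, hd, hp⟩ => hw ⟨d, hd, .head hac hp⟩
    refine ⟨n + 1, _, rfl, rfl, hs.cons (Or.inl hac) fun hn => ⟨fun _ hz => ?_, fun _ h2 => ?_⟩,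
      fun _ => hac⟩
    · exact hw ⟨_, hz, .single hac⟩
    · exact absurd h2 (h1 hn).asymm

/-- If the parents of `D` in `N` are d-separated from `u` given the rest of the family of `D`, then
some set `B` contains `u`, avoids `family D`, and with one node outside `Z = family D \ N` of the
family of an ancestor of `u` or `D` it contains all of them. -/
theorem exists_separating_set {D u : V} {N : Set V} (hND : D ∉ N)
    (hu : ∀ v, ¬ G.Adj u v) (huD : u ≠ D)
    (hsep : ∀ n ∈ N, ¬ G.DConn {n} {u} (G.family D \ {n})) :
    ∃ B : Set V, u ∈ B ∧ (∀ v ∈ G.family D, v ∉ B) ∧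
      ∀ w, G.HasDirectedPath w u ∨ G.HasDirectedPath w D → ∀ a ∈ G.family w, ∀ b ∈ G.family w,
        a ∉ G.family D \ N → b ∈ B → a ∈ B := by
  set Z := G.family D \ N with hZ
  have hDZ : D ∈ Z := ⟨Set.mem_insert _ _, hND⟩
  have huF : u ∉ G.family D := by
    rintro (h | h)
    · exact huD h
    · exact hu D h
  -- `B` is the set of nodes outside `Z` with an active walk to `u`. Walks may repeat nodes, which
  -- makes them easy to prolong; they are shortened to paths only where `hsep` is applied.
  refine ⟨{v | v ∉ Z ∧ ∃ (n : ℕ) (s : ℕ → V), s 0 = v ∧ s n = u ∧ G.IsActive Z n s},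
    ⟨fun h => huF h.1, 0, fun _ => u, rfl, rfl, ⟨by omega, by omega⟩⟩, ?_, ?_⟩
  · rintro v hv ⟨hvZ, n, s, rfl, rfl, hs⟩
    have hvN : s 0 ∈ N := by
      by_contra h
      exact hvZ ⟨hv, h⟩
    obtain ⟨m, t, ht0, htm, ht, hinj, hint⟩ := hs.exists_injOn hvN
    -- Passing from `Z` to `family D \ {t 0}` adds only nodes of `N`, which `t` avoids after its
    -- start, and more conditioning can only help the colliders.
    refine hsep _ ht0 (dConn_singleton_iff.2 ⟨m, t, rfl, htm, ⟨ht.adj, fun i hi => ⟨?_, ?_⟩⟩, hinj⟩)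
    · intro h1 h2
      exact (ht.isOpen i hi).1 h1 ⟨h2.1, hint _ (by omega) (by omega)⟩
    · intro h1 h2
      obtain ⟨d, hd, hp⟩ := (ht.isOpen i hi).2 h1 h2
      exact ⟨d, ⟨hd.1, fun h => hd.2 (by rw [h]; exact ht0)⟩, hp⟩
  -- A walk from `w` is prolonged to a parent `a`. If `w` is an ancestor of `Z`, a collider at `w`
  -- is open, and the last disjunction covers a non-collider. If not, `w` is no ancestor of `D`,
  -- hence one of `u`, and a directed path to `u` replaces the walk.
  · have up : ∀ w a, G.HasDirectedPath w u ∨ G.HasDirectedPath w D → G.Adj a w → ∀ (n : ℕ)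
        (s : ℕ → V), s 0 = w → s n = u → G.IsActive Z n s → w ∉ Z ∨ 1 ≤ n ∧ G.Adj (s 1) w →
        ∃ (n : ℕ) (s : ℕ → V), s 0 = a ∧ s n = u ∧ G.IsActive Z n s := by
      rintro _ a hw ha n s rfl rfl hs hor
      by_cases hz : ∃ d ∈ Z, G.HasDirectedPath (s 0) d
      · refine ⟨n + 1, _, rfl, rfl, hs.cons (Or.inl ha) fun hn => ⟨?_, fun _ _ => hz⟩⟩
        rintro (h | h)
        · exact absurd h ha.asymm
        · rcases hor with h' | h'
          · exact h'
          · exact absurd h h'.2.asymm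
      · have hw' := hw.resolve_right fun h => hz ⟨D, hDZ, h⟩
        obtain ⟨m, t, ht0, htm, ht, h1⟩ := exists_active_of_directedPath hw' hz
        refine ⟨m + 1, _, rfl, htm, ht.cons (Or.inl (ht0 ▸ ha)) fun hm =>
          ⟨fun _ h => ?_, fun _ h => ?_⟩⟩
        · exact hz ⟨_, h, ht0 ▸ .refl⟩
        · exact absurd h (h1 hm).asymm
    rintro w hw a ha b hb haZ ⟨hbZ, n, s, rfl, hsn, hs⟩
    refine ⟨haZ, ?_⟩
    rcases hb with hb | hb
    · rcases ha with ha | ha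
      · exact ⟨n, s, hb.trans ha.symm, hsn, hs⟩
      · exact up w a hw ha n s hb hsn hs (Or.inl (hb ▸ hbZ))
    · have hw1 : G.IsActive Z (n + 1) (fun k => Nat.casesOn k w s) :=
        hs.cons (Or.inr hb) fun _ => ⟨fun _ => hbZ, fun h => absurd h (Adj.asymm hb)⟩
      rcases ha with ha | ha
      · exact ⟨n + 1, fun k => Nat.casesOn k w s, ha.symm, hsn, hw1⟩
      · exact up w a hw ha (n + 1) (fun k => Nat.casesOn k w s) rfl hsn hw1
          (Or.inr ⟨by omega, by exact hb⟩)

end DAG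

/-! ### Solutions of the structural equations and interventions -/

namespace SCM

variable {V : Type*} [Fintype V] {G : DAG V}

/-- Allows an intervened model to be evaluated by exhibiting a solution of its equations. -/
theorem eq_eval (M : SCM G) (e : ∀ v, M.Exo v) (x : ∀ v, M.Dom v)
    (h : ∀ v, x v = M.f v (fun w => x w.1) (e v)) (v : V) : x v = M.eval e v := by
  induction v using G.wellFounded_adj.induction with
  | _ v ih =>
    rw [h, M.eval_eq]
    congr 1
    funext w
    exact ih w.1 w.2

theorem potentialResponse_of_ne [DecidableEq V] (M : SCM G) (X : V) (x : M.Dom X)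
    (e : ∀ v, M.Exo v) {v : V} (hv : v ≠ X) :
    M.potentialResponse X x e v = M.f v (fun w => M.potentialResponse X x e w.1) (e v) := by
  rw [potentialResponse, eval_eq]
  exact congrFun (congrFun (M.intervene_f_of_ne X x v hv) _) _

/-- An intervention on `X` affects only the descendants of `X`. -/
theorem potentialResponse_eq_eval [DecidableEq V] (M : SCM G) (X : V) (x : M.Dom X)
    (e : ∀ v, M.Exo v) (v : V) (hv : ¬ G.HasDirectedPath X v) :
    M.potentialResponse X x e v = M.eval e v := by
  induction v using G.wellFounded_adj.induction with
  | _ v ih =>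
    rw [M.potentialResponse_of_ne X x e (fun h => hv (h ▸ .refl)), M.eval_eq]
    congr 1
    funext w
    exact ih w.1 w.2 fun h => hv (h.tail w.2)

end SCM

/-! ### Values and utilities under a policy -/

namespace SCIM

theorem not_hasDirectedPath_of_mem_parents {V : Type*} {C : CID V} {D w : V}
    (hw : w ∈ C.parents D) :
    ¬ C.HasDirectedPath D w := fun h => h.not_adj hw

theorem kind_ne_decision {V : Type*} {C : CID V} {D : V}
    (hD : C.IsSingleDecision D) {v : V} (h : v ≠ D) :
    C.kind v ≠ NodeKind.decision := fun h' => h ((hD v).1 h')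

variable {V : Type*} [Fintype V] {C : CID V} (M : SCIM C) {D : V} (hD : C.IsSingleDecision D)

/-- The value of the node `v` under the policy `π`. -/
noncomputable def val (π : M.Policy D) (e : ∀ v, M.Exo v) (v : V) : M.Dom v :=
  (M.withPolicy hD π).eval e v

theorem val_decision (π : M.Policy D) (e : ∀ v, M.Exo v) :
    M.val hD π e D = π (fun w => M.val hD π e w.1) (e D) := by
  rw [val, SCM.eval_eq]
  exact congrFun (congrFun (M.withPolicy_f_decision hD π) _) _

theorem val_of_ne (π : M.Policy D) (e : ∀ v, M.Exo v) {v : V} (hv : v ≠ D) :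
    M.val hD π e v =
      M.f v (kind_ne_decision hD hv) (fun w => M.val hD π e w.1) (e v) := by
  rw [val, SCM.eval_eq]
  exact congrFun (congrFun (M.withPolicy_f_of_ne hD π v (kind_ne_decision hD hv)) _) _

/-- On a set of nodes that contains the parents of its members other than `D`, the values depend
only on the exogenous variables of its members and on the decision. -/
theorem val_congr {π π' : M.Policy D} {e e' : ∀ v, M.Exo v} (S : Set V)
    (hS : ∀ v ∈ S, v ≠ D → ∀ w, C.Adj w v → w ∈ S) (he : ∀ v ∈ S, v ≠ D → e v = e' v)
    (hDS : D ∈ S → M.val hD π e D = M.val hD π' e' D) (v : V) (hv : v ∈ S) :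
    M.val hD π e v = M.val hD π' e' v := by
  induction v using C.wellFounded_adj.induction with
  | _ v ih =>
    by_cases hvD : v = D
    · subst hvD
      exact hDS hv
    · rw [val_of_ne M hD π e hvD, val_of_ne M hD π' e' hvD, he v hv hvD]
      congr 1
      funext w
      exact ih w.1 w.2 (hS v hv hvD w.1 w.2)

/-- The policy that always decides `d`. -/
def constPolicy (d : M.Dom D) : M.Policy D := fun _ _ => d

theorem val_constPolicy_decision (d : M.Dom D) (e : ∀ v, M.Exo v) :
    M.val hD (M.constPolicy d) e D = d := val_decision M hD _ e

theorem val_eq_val_constPolicy (π : M.Policy D) (e : ∀ v, M.Exo v) (v : V) :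
    M.val hD π e v = M.val hD (M.constPolicy (M.val hD π e D)) e v :=
  M.val_congr hD Set.univ (fun _ _ _ _ _ => trivial) (fun _ _ _ => rfl)
    (fun _ => (M.val_constPolicy_decision hD _ e).symm) v trivial

theorem val_eq_of_not_descendant (π π' : M.Policy D) (e : ∀ v, M.Exo v) {v : V}
    (hv : ¬ C.HasDirectedPath D v) : M.val hD π e v = M.val hD π' e v :=
  M.val_congr hD {v | ¬ C.HasDirectedPath D v} (fun _ h _ _ hw h' => h (h'.tail hw))
    (fun _ _ _ => rfl) (fun h => absurd .refl h) v hv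

/-- The values of the parents of the decision. -/
noncomputable def observation (e : ∀ v, M.Exo v) (w : C.parents D) : M.Dom w :=
  M.val hD (M.constPolicy (Classical.arbitrary _)) e w

theorem val_parents (π : M.Policy D) (e : ∀ v, M.Exo v) (w : C.parents D) :
    M.val hD π e w = M.observation hD e w :=
  M.val_eq_of_not_descendant hD _ _ e (not_hasDirectedPath_of_mem_parents w.2)

/-- The contribution of the utility node `u` if the decision is `d`. -/
noncomputable def utilityAt (u : {u : V // C.kind u = NodeKind.utility}) (d : M.Dom D)
    (e : ∀ v, M.Exo v) : ℝ :=
  M.util u.1 u.2 (M.val hD (M.constPolicy d) e u.1)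

theorem totalUtility_eq (π : M.Policy D) (e : ∀ v, M.Exo v) :
    M.totalUtility hD π e = ∑ u, M.utilityAt hD u (π (M.observation hD e) (e D)) e := by
  refine Finset.sum_congr rfl fun u _ => ?_
  have h : M.val hD π e D = π (M.observation hD e) (e D) := by
    rw [val_decision]
    congr 1
    funext w
    exact M.val_parents hD π e w
  have := M.val_eq_val_constPolicy hD π e u.1
  rw [h] at this
  rw [utilityAt, ← this, val]

open Classical in
/-- The setting that agrees with `e` on `S` and with `e'` elsewhere. -/
noncomputable def mix (S : Set V) (e e' : ∀ v, M.Exo v) (v : V) : M.Exo v :=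
  if v ∈ S then e v else e' v

theorem mix_mix (S : Set V) (e e' : ∀ v, M.Exo v) :
    M.mix S (M.mix S e e') (M.mix S e' e) = e := by
  funext v
  by_cases h : v ∈ S <;> simp [mix, h]

/-- By independence both sides are products over the nodes, and the exchange only permutes the two
factors at each node of `S`. -/
theorem weight_mix (S : Set V) (e e' : ∀ v, M.Exo v) :
    (M.P (M.mix S e e')).toReal * (M.P (M.mix S e' e)).toReal =
      (M.P e).toReal * (M.P e').toReal := by
  simp only [M.indep _, ENNReal.toReal_prod, ← Finset.prod_mul_distrib]
  refine Finset.prod_congr rfl fun v _ => ?_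
  by_cases h : v ∈ S <;> simp [mix, h, mul_comm]

/-! ### Conditional independence by exchanging noise -/

section Swap

variable {N B : Set V} {u : V}

/-- Noise is taken from `e` at the nodes whose family meets `B`, and from `e'` elsewhere. In the
first case the closure property puts the whole family into `B ∪ (family D \ N)`; in the second no
parent is in `B`. On `family D \ N` the two settings agree, so the two descriptions are consistent
there. -/
theorem val_mix (hN : D ∉ N) (hB : ∀ v ∈ C.family D, v ∉ B)
    (hcl : ∀ w, C.HasDirectedPath w u ∨ C.HasDirectedPath w D → ∀ a ∈ C.family w,
      ∀ b ∈ C.family w, a ∉ C.family D \ N → b ∈ B → a ∈ B)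
    {e e' : ∀ v, M.Exo v} (d : M.Dom D)
    (he : ∀ w (hw : w ∈ C.parents D), w ∉ N →
      M.observation hD e ⟨w, hw⟩ = M.observation hD e' ⟨w, hw⟩)
    (v : V) (hv : C.HasDirectedPath v u ∨ C.HasDirectedPath v D) :
    (v ∈ B ∪ (C.family D \ N) →
      M.val hD (M.constPolicy d) (M.mix {v | ∃ b ∈ C.family v, b ∈ B} e e') v =
        M.val hD (M.constPolicy d) e v) ∧
    (v ∉ B →
      M.val hD (M.constPolicy d) (M.mix {v | ∃ b ∈ C.family v, b ∈ B} e e') v =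
        M.val hD (M.constPolicy d) e' v) := by
  have hZ : ∀ v ∈ C.family D \ N,
      M.val hD (M.constPolicy d) e v = M.val hD (M.constPolicy d) e' v := by
    rintro v ⟨rfl | hv, hvN⟩
    · simp only [val_constPolicy_decision]
    · have := he v hv hvN
      rwa [← M.val_parents hD (M.constPolicy d), ← M.val_parents hD (M.constPolicy d)] at this
  induction v using C.wellFounded_adj.induction with
  | _ v ih =>
    by_cases hvD : v = D
    · subst hvD
      simp only [val_constPolicy_decision, implies_true, and_self]
    have hpar : ∀ w, C.Adj w v → C.HasDirectedPath w u ∨ C.HasDirectedPath w D := fun w hw =>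
      hv.imp (.head hw) (.head hw)
    by_cases hS : v ∈ {v | ∃ b ∈ C.family v, b ∈ B}
    · have key : M.val hD (M.constPolicy d) (M.mix {v | ∃ b ∈ C.family v, b ∈ B} e e') v =
          M.val hD (M.constPolicy d) e v := by
        rw [val_of_ne M hD _ _ hvD, val_of_ne M hD _ _ hvD, mix, if_pos hS]
        obtain ⟨b, hb, hbB⟩ := hS
        congr 1
        funext w
        refine (ih w.1 w.2 (hpar _ w.2)).1 ?_
        by_cases hw : w.1 ∈ C.family D \ N
        · exact Or.inr hw
        · exact Or.inl (hcl v hv _ (Or.inr w.2) b hb hw hbB)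
      refine ⟨fun _ => key, fun hvB => ?_⟩
      obtain ⟨b, hb, hbB⟩ := hS
      rw [key]
      refine hZ v ?_
      by_contra hvZ
      exact hvB (hcl v hv v (Or.inl rfl) b hb hvZ hbB)
    · have key : M.val hD (M.constPolicy d) (M.mix {v | ∃ b ∈ C.family v, b ∈ B} e e') v =
          M.val hD (M.constPolicy d) e' v := by
        rw [val_of_ne M hD _ _ hvD, val_of_ne M hD _ _ hvD, mix, if_neg hS]
        congr 1
        funext w
        exact (ih w.1 w.2 (hpar _ w.2)).2 fun hwB => hS ⟨w.1, Or.inr w.2, hwB⟩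
      refine ⟨fun hvBZ => ?_, fun _ => key⟩
      rcases hvBZ with hvB | hvZ
      · exact absurd ⟨v, Or.inl rfl, hvB⟩ hS
      · rw [key, hZ v hvZ]

open Classical in
/-- The settings at which the parents of `D` outside `N` have the values `p`. -/
noncomputable def agreeing (N : Set V) (p : ∀ w : C.parents D, M.Dom w) :
    Finset (∀ v, M.Exo v) :=
  {e | ∀ w : C.parents D, w.1 ∉ N → M.observation hD e w = p w}

open Classical in
/-- The settings at which the policies see the values `p` and the exogenous value `ε`. -/
noncomputable def seeing (p : ∀ w : C.parents D, M.Dom w) (ε : M.Exo D) :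
    Finset (∀ v, M.Exo v) :=
  {e | M.observation hD e = p ∧ e D = ε}

/-- Given the other parents of `D`, the utility `u` does not depend on the parents in `N`. -/
theorem sum_seeing_mul_sum_agreeing (hN : D ∉ N) (u : {u : V // C.kind u = NodeKind.utility})
    (huB : u.1 ∈ B) (hB : ∀ v ∈ C.family D, v ∉ B)
    (hcl : ∀ w, C.HasDirectedPath w u.1 ∨ C.HasDirectedPath w D → ∀ a ∈ C.family w,
      ∀ b ∈ C.family w, a ∉ C.family D \ N → b ∈ B → a ∈ B)
    (p : ∀ w : C.parents D, M.Dom w) (ε : M.Exo D) (d : M.Dom D) :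
    (∑ e ∈ M.seeing hD p ε, (M.P e).toReal * M.utilityAt hD u d e) *
        ∑ e ∈ M.agreeing hD N p, (M.P e).toReal =
      (∑ e ∈ M.agreeing hD N p, (M.P e).toReal * M.utilityAt hD u d e) *
        ∑ e ∈ M.seeing hD p ε, (M.P e).toReal := by
  rw [Finset.sum_mul_sum, Finset.sum_mul_sum, ← Finset.sum_product', ← Finset.sum_product']
  set S : Set V := {v | ∃ b ∈ C.family v, b ∈ B} with hS
  have hDS : D ∉ S := fun ⟨b, hb, hbB⟩ => hB b hb hbB
  have hobs : ∀ e e' : ∀ v, M.Exo v,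
      (∀ w (hw : w ∈ C.parents D), w ∉ N →
        M.observation hD e ⟨w, hw⟩ = M.observation hD e' ⟨w, hw⟩) →
      M.observation hD (M.mix S e e') = M.observation hD e' := by
    intro e e' h
    funext w
    rw [← M.val_parents hD (M.constPolicy d), ← M.val_parents hD (M.constPolicy d)]
    exact (M.val_mix hD hN hB hcl d h w.1 (Or.inr (.single w.2))).2 (hB _ (Or.inr w.2))
  have hmixD : ∀ e e' : ∀ v, M.Exo v, M.mix S e e' D = e' D := fun e e' => if_neg hDS
  -- `mix S e e'` keeps the utility of `e` but takes the observation and the noise of `D` from `e'`.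
  -- The exchange therefore carries pairs in `seeing × agreeing` to pairs in `agreeing × seeing`,
  -- and it is its own inverse.
  refine Finset.sum_nbij' (fun x => (M.mix S x.1 x.2, M.mix S x.2 x.1))
    (fun x => (M.mix S x.1 x.2, M.mix S x.2 x.1)) ?_ ?_ ?_ ?_ ?_
  · rintro ⟨e, e'⟩ h
    simp only [Finset.mem_product, seeing, agreeing, Finset.mem_filter_univ] at h ⊢
    obtain ⟨⟨h1, h2⟩, h3⟩ := h
    refine ⟨?_, ?_, by rw [hmixD, h2]⟩
    · rw [hobs e e' fun w hw hwN => by rw [h3 ⟨w, hw⟩ hwN, h1]]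
      exact h3
    · rw [hobs e' e fun w hw hwN => by rw [h3 ⟨w, hw⟩ hwN, h1], h1]
  · rintro ⟨e, e'⟩ h
    simp only [Finset.mem_product, seeing, agreeing, Finset.mem_filter_univ] at h ⊢
    obtain ⟨h3, h1, h2⟩ := h
    refine ⟨⟨?_, by rw [hmixD, h2]⟩, ?_⟩
    · rw [hobs e e' fun w hw hwN => by rw [h3 ⟨w, hw⟩ hwN, h1], h1]
    · rw [hobs e' e fun w hw hwN => by rw [h3 ⟨w, hw⟩ hwN, h1]]
      exact h3
  · rintro ⟨e, e'⟩ -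
    simp only [mix_mix]
  · rintro ⟨e, e'⟩ -
    simp only [mix_mix]
  · rintro ⟨e, e'⟩ h
    simp only [Finset.mem_product, seeing, agreeing, Finset.mem_filter_univ] at h ⊢
    obtain ⟨⟨h1, h2⟩, h3⟩ := h
    have hu : M.utilityAt hD u d (M.mix S e e') = M.utilityAt hD u d e := by
      rw [utilityAt, (M.val_mix hD hN hB hcl d
        (fun w hw hwN => by rw [h3 ⟨w, hw⟩ hwN, h1]) u.1 (Or.inl .refl)).1 (Or.inl huB), utilityAt]
    rw [hu]
    linear_combination (-M.utilityAt hD u d e) * M.weight_mix S e e'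

end Swap

/-! ### Optimal policies that ignore separated observations -/

/-- If every node of `N` is d-separated, given the rest of the family of `D`, from every utility
node that the decision can influence, then some optimal policy ignores `N` and the exogenous
variable of `D`. -/
theorem exists_isOptimal_of_dSep [DecidableEq V] {N : Set V} (hN : N ⊆ C.parents D)
    (hsep : ∀ n ∈ N, ∀ u, C.kind u = NodeKind.utility → C.HasDirectedPath D u →
      ¬ C.DConn {n} {u} (C.family D \ {n})) :
    ∃ π : M.Policy D, M.IsOptimal hD π ∧ ∀ p p' ε ε', (∀ w : C.parents D, w.1 ∉ N → p w = p' w) →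
      π p ε = π p' ε' := by
  classical
  have hDN : D ∉ N := fun h => DAG.Adj.ne (hN h) rfl
  have hex : ∀ g : M.Dom D → ℝ, ∃ d, ∀ d', g d' ≤ g d := fun g => Finite.exists_max g
  choose argmax hargmax using hex
  let H : (∀ w : C.parents D, M.Dom w) → M.Dom D → ℝ := fun p d =>
    ∑ e ∈ M.agreeing hD N p, (M.P e).toReal * ∑ u, M.utilityAt hD u d e
  obtain ⟨ρ, hρ⟩ : ∃ ρ : M.Policy D, ∀ p ε, ρ p ε = argmax (H p) :=
    ⟨fun p _ => argmax (H p), fun _ _ => rfl⟩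
  refine ⟨ρ, fun π => ?_, fun p p' _ _ h => ?_⟩
  swap
  · have : M.agreeing hD N p = M.agreeing hD N p' := by
      ext e
      simp only [agreeing, Finset.mem_filter_univ]
      exact forall_congr' fun w => forall_congr' fun hw => by rw [h w hw]
    simp only [hρ, H, this]
  · have := fun v => Fintype.ofFinite (M.Dom v)
    unfold expectedUtility
    -- The expectations are split by what a policy sees; on each fibre a policy makes a single
    -- decision.
    rw [← Finset.sum_fiberwise _ (fun e => (M.observation hD e, e D)),
      ← Finset.sum_fiberwise _ (fun e => (M.observation hD e, e D))]
    refine Finset.sum_le_sum fun pe _ => ?_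
    obtain ⟨p, ε⟩ := pe
    have hfil : ({e : ∀ v, M.Exo v | (M.observation hD e, e D) = (p, ε)} : Finset _) =
        M.seeing hD p ε := by
      ext e
      simp [seeing]
    rw [hfil, ← sub_nonneg, ← Finset.sum_sub_distrib]
    have hval : ∀ e ∈ M.seeing hD p ε, ∀ ρ : M.Policy D,
        M.totalUtility hD ρ e = ∑ u, M.utilityAt hD u (ρ p ε) e := by
      intro e he ρ
      simp only [seeing, Finset.mem_filter_univ] at he
      rw [totalUtility_eq, he.1, he.2]
    rw [Finset.sum_congr rfl fun e he => by rw [hval e he, hval e he, hρ]]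
    set d₁ := argmax (H p) with hd₁
    set d₂ := π p ε
    have hsub : M.seeing hD p ε ⊆ M.agreeing hD N p := by
      intro e he
      simp only [seeing, agreeing, Finset.mem_filter_univ] at he ⊢
      exact fun w _ => by rw [he.1]
    have hH : H p d₂ ≤ H p d₁ := hargmax (H p) d₂
    have hunit : ∀ u, (∑ e ∈ M.seeing hD p ε,
          (M.P e).toReal * (M.utilityAt hD u d₁ e - M.utilityAt hD u d₂ e)) *
            ∑ e ∈ M.agreeing hD N p, (M.P e).toReal =
        (∑ e ∈ M.agreeing hD N p,
          (M.P e).toReal * (M.utilityAt hD u d₁ e - M.utilityAt hD u d₂ e)) *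
            ∑ e ∈ M.seeing hD p ε, (M.P e).toReal := by
      intro u
      by_cases hu : C.HasDirectedPath D u.1
      · have huD : u.1 ≠ D := by
          intro h
          have h1 := u.2
          rw [h, (hD D).2 rfl] at h1
          cases h1
        obtain ⟨B, huB, hB, hcl⟩ := DAG.exists_separating_set (G := C.toDAG) hDN
          (fun v => C.utility_no_children u.1 v u.2) huD fun n hn => hsep n hn u.1 u.2 hu
        have h1 := M.sum_seeing_mul_sum_agreeing hD hDN u huB hB hcl p ε d₁
        have h2 := M.sum_seeing_mul_sum_agreeing hD hDN u huB hB hcl p ε d₂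
        simp only [mul_sub, Finset.sum_sub_distrib, sub_mul, h1, h2]
      · have h0 : ∀ e, M.utilityAt hD u d₁ e = M.utilityAt hD u d₂ e := fun e => by
          rw [utilityAt, M.val_eq_of_not_descendant hD _ (M.constPolicy d₂) e hu, utilityAt]
        simp [h0]
    have hcomm : ∀ s : Finset (∀ v, M.Exo v),
        ∑ u, ∑ e ∈ s, (M.P e).toReal * (M.utilityAt hD u d₁ e - M.utilityAt hD u d₂ e) =
          ∑ e ∈ s,
            (M.P e).toReal * (∑ u, M.utilityAt hD u d₁ e - ∑ u, M.utilityAt hD u d₂ e) := by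
      intro s
      rw [Finset.sum_comm]
      simp only [← Finset.mul_sum, Finset.sum_sub_distrib]
    have htot := Finset.sum_congr rfl fun u (_ : u ∈ Finset.univ) => hunit u
    rw [← Finset.sum_mul, ← Finset.sum_mul, hcomm, hcomm] at htot
    simp only [← mul_sub]
    have hA : 0 ≤ ∑ e ∈ M.agreeing hD N p,
        (M.P e).toReal * (∑ u, M.utilityAt hD u d₁ e - ∑ u, M.utilityAt hD u d₂ e) := by
      simp only [mul_sub, Finset.sum_sub_distrib]
      exact sub_nonneg.2 hH
    -- If the larger event has weight zero, so has every setting in the fibre. Otherwise `htot` can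
    -- be divided by this weight, and the sign comes from the choice of `d₁`.
    rcases (Finset.sum_nonneg fun e (_ : e ∈ M.agreeing hD N p) =>
      (ENNReal.toReal_nonneg : 0 ≤ (M.P e).toReal)).eq_or_lt with h0 | hpos
    · rw [eq_comm, Finset.sum_eq_zero_iff_of_nonneg fun _ _ => ENNReal.toReal_nonneg] at h0
      exact (Finset.sum_eq_zero fun e he => by rw [h0 e (hsub he), zero_mul]).ge
    · refine nonneg_of_mul_nonneg_left ?_ hpos
      rw [htot]
      exact mul_nonneg hA (Finset.sum_nonneg fun _ _ => ENNReal.toReal_nonneg)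

end SCIM

/-- A response incentive on `X` is possible only if the graphical criterion holds. -/
theorem CID.CompatibleWithResponseIncentive.exists_dConn {V : Type*} [Fintype V] [DecidableEq V]
    {C : CID V} {D : V} {hD : C.IsSingleDecision D} {X : V} (hX : X ≠ D)
    (h : C.CompatibleWithResponseIncentive hD X) :
    ∃ W U : V, W ∈ C.parents D ∧ C.kind U = NodeKind.utility ∧ C.HasDirectedPath X W ∧
      C.HasDirectedPath D U ∧ C.DConn {W} {U} (C.family D \ {W}) := by
  obtain ⟨M, hM⟩ := h
  by_contra hno
  obtain ⟨π, hopt, hπ⟩ := M.exists_isOptimal_of_dSep hD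
    (N := {n | n ∈ C.parents D ∧ ∀ u, C.kind u = NodeKind.utility → C.HasDirectedPath D u →
      ¬ C.DConn {n} {u} (C.family D \ {n})}) (fun n hn => hn.1) (fun n hn => hn.2)
  obtain ⟨x, e, hne⟩ := hM π hopt
  refine hne ?_
  rw [(M.withPolicy hD π).potentialResponse_of_ne X x e hX.symm, SCM.eval_eq,
    M.withPolicy_f_decision hD π]
  refine hπ _ _ _ _ fun w hw => (M.withPolicy hD π).potentialResponse_eq_eval X x e
    w.1 fun hXw => hw ⟨w.2, ?_⟩
  exact fun u hu hDu hc => hno ⟨w.1, u, w.2, hu, hXw, hDu, hc⟩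

/-! ### Geometry of the incentive path -/

/-- The data of the graphical criterion: an active path `q` from the parent `q 0` of the decision
`D` to the utility node `q n`, where `X` is an ancestor of `q 0` and `D` of `q n`. -/
structure CID.IncentivePath {V : Type*} (C : CID V) (D X : V) where
  /-- The length of the path. -/
  n : ℕ
  /-- The nodes of the path. -/
  q : ℕ → V
  ne : X ≠ D
  kind_decision : C.kind D = NodeKind.decision
  adj_decision : C.Adj (q 0) D
  kind_last : C.kind (q n) = NodeKind.utility
  path_observation : C.HasDirectedPath X (q 0)
  path_utility : C.HasDirectedPath D (q n)
  active : C.IsActive (C.family D \ {q 0}) n q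
  inj : Set.InjOn q {k | k ≤ n}

namespace CID.IncentivePath

variable {V : Type*} {C : CID V} {D X : V} (I : C.IncentivePath D X)

/-- The path has a collider at position `i`. -/
def IsCollider (i : ℕ) : Prop :=
  C.Adj (I.q (i - 1)) (I.q i) ∧ C.Adj (I.q (i + 1)) (I.q i)

/-- Since `0 - 1 = 0`, the left neighbour of `q 0` is `q 0` itself, which is not its own parent. -/
theorem not_isCollider_zero : ¬ I.IsCollider 0 := fun h => DAG.Adj.ne h.1 rfl

theorem kind_ne_utility {C : CID V} {v w : V} (h : C.Adj v w) :
    C.kind v ≠ NodeKind.utility := fun h' => C.utility_no_children v w h' h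

theorem kind_ne_utility_of_path {C : CID V} {v w : V} (h : C.HasDirectedPath v w) (hne : v ≠ w) :
    C.kind v ≠ NodeKind.utility := by
  rcases h.cases_head with h | ⟨c, hc, -⟩
  · exact absurd h hne
  · exact kind_ne_utility hc

theorem n_pos : 0 < I.n := by
  refine Nat.pos_of_ne_zero fun h => kind_ne_utility I.adj_decision ?_
  have := I.kind_last
  rwa [h] at this

theorem adj_last : C.Adj (I.q (I.n - 1)) (I.q I.n) := by
  have h := I.active.adj (I.n - 1) (Nat.sub_lt I.n_pos one_pos)
  rw [show I.n - 1 + 1 = I.n from Nat.sub_add_cancel I.n_pos] at h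
  exact h.resolve_right fun h => kind_ne_utility h I.kind_last

theorem last_ne_decision : I.q I.n ≠ D := fun h => by
  have h1 := I.kind_last
  rw [h, I.kind_decision] at h1
  cases h1

theorem openAt {i : ℕ} (h0 : 0 < i) (hi : i < I.n) :
    C.OpenAt (C.family D \ {I.q 0}) (I.q (i - 1)) (I.q i) (I.q (i + 1)) := by
  have := I.active.isOpen (i - 1) (by omega)
  rwa [show i - 1 + 1 = i by omega, show i - 1 + 2 = i + 1 by omega] at this

theorem adj_left {i : ℕ} (h0 : 0 < i) (hi : i ≤ I.n) :
    C.Adj (I.q (i - 1)) (I.q i) ∨ C.Adj (I.q i) (I.q (i - 1)) := by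
  have := I.active.adj (i - 1) (by omega)
  rwa [show i - 1 + 1 = i by omega] at this

theorem q_ne_zero {i : ℕ} (h0 : 0 < i) (hi : i ≤ I.n) : I.q i ≠ I.q 0 := fun h =>
  h0.ne' (I.inj hi (Nat.zero_le _) h)

theorem not_mem_family {i : ℕ} (h0 : 0 < i) (hi : i < I.n) (hc : ¬ I.IsCollider i) :
    I.q i ∉ C.family D := by
  intro hF
  refine (I.openAt h0 hi).1 ?_ ⟨hF, I.q_ne_zero h0 hi.le⟩
  rcases I.adj_left h0 hi.le with h | h
  · rcases I.active.adj i hi with h' | h'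
    · exact Or.inr h'
    · exact absurd ⟨h, h'⟩ hc
  · exact Or.inl h

theorem not_isCollider_of_adj_left {i : ℕ} (h : C.Adj (I.q (i - 1)) (I.q i)) :
    ¬ I.IsCollider (i - 1) := by
  intro hc
  rcases Nat.eq_zero_or_pos i with rfl | hi
  · exact DAG.Adj.ne h rfl
  · have := hc.2
    rw [show i - 1 + 1 = i by omega] at this
    exact DAG.Adj.asymm h this

theorem not_isCollider_of_adj_right {i : ℕ} (h : C.Adj (I.q (i + 1)) (I.q i)) :
    ¬ I.IsCollider (i + 1) := fun hc => DAG.Adj.asymm h hc.1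

theorem succ_lt_of_adj {i : ℕ} (hi : i < I.n) (h : C.Adj (I.q (i + 1)) (I.q i)) :
    i + 1 < I.n := by
  refine lt_of_le_of_ne hi fun he => kind_ne_utility h ?_
  rw [he]
  exact I.kind_last

/-- As a non-collider `D` would block the path. As a collider it would make the next node a parent
of `D` and a non-collider, which blocks as well. -/
theorem q_ne_decision {i : ℕ} (hi : i < I.n) : I.q i ≠ D := by
  intro hD
  rcases Nat.eq_zero_or_pos i with rfl | h0
  · exact DAG.Adj.ne I.adj_decision hD
  · by_cases hc : I.IsCollider i
    · have h1 := hc.2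
      refine I.not_mem_family (Nat.succ_pos i) (I.succ_lt_of_adj hi h1)
        (I.not_isCollider_of_adj_right h1) (Or.inr ?_)
      rw [hD] at h1
      exact h1
    · exact I.not_mem_family h0 hi hc (Or.inl hD)

theorem IsCollider.path {I : C.IncentivePath D X} {i : ℕ} (hi : i < I.n) (hc : I.IsCollider i) :
    C.HasDirectedPath (I.q i) D := by
  have h0 : 0 < i := Nat.pos_of_ne_zero fun h => I.not_isCollider_zero (h ▸ hc)
  obtain ⟨d, ⟨rfl | hd, -⟩, hp⟩ := (I.openAt h0 hi).2 hc.1 hc.2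
  · exact hp
  · exact hp.tail hd

theorem kind_q_ne_utility {i : ℕ} (hi : i < I.n) : C.kind (I.q i) ≠ NodeKind.utility := by
  by_cases hc : I.IsCollider i
  · exact kind_ne_utility_of_path (hc.path hi) (I.q_ne_decision hi)
  · rcases I.active.adj i hi with h | h
    · exact kind_ne_utility h
    · rcases Nat.eq_zero_or_pos i with rfl | h0
      · exact kind_ne_utility I.adj_decision
      · exact kind_ne_utility ((I.adj_left h0 hi.le).resolve_left fun h' => hc ⟨h', h⟩)

/-! ### The model with masked path bits -/

/-- The values of the nodes: a bit for the path, which is `0` if it is masked, and a table of bits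
that are passed on to all descendants: those of the colliders, the mask (sent by `X`) and the
decision. -/
abbrev Message : Type := SignType × (Fin I.n ⊕ Bool → SignType)

/-- The node that sends an entry of the table. -/
def origin : Fin I.n ⊕ Bool → V
  | .inl i => I.q i
  | .inr false => X
  | .inr true => D

open Classical in
/-- The message of the parent `w`, with a default value if `w` is not a parent. -/
noncomputable def input {v : V} (pa : C.parents v → I.Message) (w : V) : I.Message :=
  -- The default is neutral, so neighbours that are not parents drop out of the product in
  -- `pathBit`.
  if h : C.Adj w v then pa ⟨w, h⟩ else (1, fun _ => 1)

open Classical in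
/-- A parent of `v` that descends from the origin of the entry `k`, if there is one. -/
noncomputable def via (v : V) (k : Fin I.n ⊕ Bool) : V :=
  if h : ∃ w, C.Adj w v ∧ C.HasDirectedPath (I.origin k) w then h.choose else v

theorem via_spec {v : V} {k : Fin I.n ⊕ Bool} (h : C.HasDirectedPath (I.origin k) v)
    (hne : v ≠ I.origin k) : C.Adj (I.via v k) v ∧ C.HasDirectedPath (I.origin k) (I.via v k) := by
  have hex : ∃ w, C.Adj w v ∧ C.HasDirectedPath (I.origin k) w := by
    rcases h.cases_tail with h | ⟨w, h1, h2⟩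
    · exact absurd h hne
    · exact ⟨w, h2, h1⟩
  rw [via, dif_pos hex]
  exact hex.choose_spec

/-- The position of a node on the path. -/
noncomputable def pos (v : V) : ℕ := Function.invFunOn I.q {k | k ≤ I.n} v

theorem pos_q {i : ℕ} (hi : i ≤ I.n) : I.pos (I.q i) = i := I.inj.leftInvOn_invFunOn hi

open Classical in
/-- The bit that determines whether the path bit of `q 0` is masked. -/
noncomputable def mask (m : SignType) (v : V) (pa : C.parents v → I.Message) : SignType :=
  if v = X then m else (I.input pa (I.via v (.inr false))).2 (.inr false)

/-- The sign that represents an exogenous bit. -/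
def sign (b : Bool) : SignType := if b then 1 else -1

open Classical in
/-- The path bit: the product of the bits of those neighbours on the path that are parents, or the
exogenous bit if there are none. -/
noncomputable def pathBit (m : SignType) (v : V) (pa : C.parents v → I.Message) (ε : Bool) :
    SignType :=
  if ∃ i ≤ I.n, I.q i = v then
    (if v = I.q 0 then I.mask m v pa else 1) *
      (I.input pa (I.q (I.pos v - 1))).1 * (I.input pa (I.q (I.pos v + 1))).1 *
      (if C.Adj (I.q (I.pos v - 1)) v ∨ C.Adj (I.q (I.pos v + 1)) v then 1 else sign ε)
  else 1

open Classical in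
/-- The entry of the table that the node `v` sends. -/
noncomputable def sent (m : SignType) (v : V) (pa : C.parents v → I.Message) (ε : Bool) :
    Fin I.n ⊕ Bool → SignType
  | .inl i => if I.IsCollider i then I.pathBit m v pa ε else 1
  | .inr false => m
  | .inr true => 1

open Classical in
/-- The table of bits that are passed on to all descendants. -/
noncomputable def table (m : SignType) (v : V) (pa : C.parents v → I.Message) (ε : Bool)
    (k : Fin I.n ⊕ Bool) : SignType :=
  if v = I.origin k then I.sent m v pa ε k else (I.input pa (I.via v k)).2 k

/-- All nodes share the domain `Message`, so a utility domain must embed all of it in `ℝ`, although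
only two of its values will be attained. -/
theorem exists_embedding : ∃ (ι : I.Message ↪ ℝ) (good bad : I.Message), ι bad < ι good := by
  have ι : I.Message ↪ ℝ :=
    (Finite.equivFin I.Message).toEmbedding.trans (Fin.valEmbedding.trans Nat.castEmbedding)
  have hne : ι (1, fun _ => 1) ≠ ι (-1, fun _ => 1) := fun h => by
    have := congrArg Prod.fst (ι.injective h)
    exact absurd (show (1 : SignType) = -1 from this) (by decide)
  rcases hne.lt_or_gt with h | h
  · exact ⟨ι, _, _, h⟩
  · exact ⟨ι, _, _, h⟩

/-- The values of the utility nodes. -/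
noncomputable def utility : I.Message ↪ ℝ := I.exists_embedding.choose

/-- The value of `q n` if the decision is right. -/
noncomputable def good : I.Message := I.exists_embedding.choose_spec.choose

/-- The value of `q n` if the decision is wrong. -/
noncomputable def bad : I.Message := I.exists_embedding.choose_spec.choose_spec.choose

theorem utility_bad_lt : I.utility I.bad < I.utility I.good :=
  I.exists_embedding.choose_spec.choose_spec.choose_spec

open Classical in
/-- The structural functions. The utility node `q n` compares the decision with the last bit of
the path. -/
noncomputable def structural (m : SignType) (v : V) (pa : C.parents v → I.Message) (ε : Bool) :
    I.Message :=
  if C.kind v = NodeKind.utility then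
    if v = I.q I.n ∧
        (I.input pa (I.q (I.n - 1))).1 = (I.input pa (I.via v (.inr true))).2 (.inr true) then
      I.good
    else I.bad
  else (I.pathBit m v pa ε, I.table m v pa ε)

/-- Flipping all bits preserves the uniform distribution and exchanges the two values of a
coordinate, so every marginal is `1/2`. -/
theorem mutuallyIndependent_uniform [Fintype V] [DecidableEq V] :
    MutuallyIndependent (PMF.uniformOfFintype (V → Bool)) := by
  have key : ∀ (v : V) (b : Bool),
      ((PMF.uniformOfFintype (V → Bool)).map fun e => e v) b = 2⁻¹ := by
    intro v b
    have hsum := ((PMF.uniformOfFintype (V → Bool)).map fun e => e v).tsum_coe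
    have hflip : ((PMF.uniformOfFintype (V → Bool)).map fun e => e v) true =
        ((PMF.uniformOfFintype (V → Bool)).map fun e => e v) false := by
      simp only [PMF.map_apply, PMF.uniformOfFintype_apply]
      rw [← (Equiv.piCongrRight fun _ : V => Equiv.boolNot).tsum_eq]
      refine tsum_congr fun e => ?_
      simp
    rw [tsum_fintype, Fintype.sum_bool] at hsum
    have h2 : 2 * ((PMF.uniformOfFintype (V → Bool)).map fun e => e v) b = 1 := by
      rw [two_mul]
      cases b
      · rwa [hflip] at hsum
      · rwa [← hflip] at hsum
    exact ENNReal.eq_inv_of_mul_eq_one_left (by rwa [mul_comm] at h2)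
  intro e
  simp only [key, PMF.uniformOfFintype_apply, Finset.prod_const]
  simp [ENNReal.inv_pow]

variable [Fintype V]

/-- The model in which the node `X` sends the mask `m`. -/
@[reducible] noncomputable def model [DecidableEq V] (m : SignType) : SCIM C where
  Dom _ := I.Message
  util _ _ := I.utility
  Exo _ := Bool
  f v _ := I.structural m v
  P := PMF.uniformOfFintype (V → Bool)
  indep := mutuallyIndependent_uniform

end CID.IncentivePath

/-! ### Propagation of bits along the path -/

namespace CID.IncentivePath

variable {V : Type*} {C : CID V} {D X : V} (I : C.IncentivePath D X)

/-- The values `x` satisfy the structural equations of all nodes but the decision. -/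
def IsSolution (m : SignType) (e : V → Bool) (x : V → I.Message) : Prop :=
  ∀ v, v ≠ D → x v = I.structural m v (fun w => x w.1) (e v)

variable {I} {m : SignType} {e : V → Bool} {x : V → I.Message}

theorem input_of_adj {v w : V} (h : C.Adj w v) : I.input (fun w : C.parents v => x w.1) w = x w :=
  dif_pos h

theorem input_of_not_adj {v w : V} (h : ¬ C.Adj w v) (pa : C.parents v → I.Message) :
    I.input pa w = (1, fun _ => 1) :=
  dif_neg h

namespace IsSolution

theorem eq_of_ne (hx : I.IsSolution m e x) {v : V} (hv : v ≠ D) (hu : C.kind v ≠ .utility) :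
    x v = (I.pathBit m v (fun w => x w.1) (e v), I.table m v (fun w => x w.1) (e v)) := by
  rw [hx v hv, structural, if_neg hu]

theorem pathBit_eq (hx : I.IsSolution m e x) {v : V} (hv : v ≠ D) (hu : C.kind v ≠ .utility) :
    I.pathBit m v (fun w => x w.1) (e v) = (x v).1 := by
  rw [hx.eq_of_ne hv hu]

theorem table_origin (hx : I.IsSolution m e x) (k : Fin I.n ⊕ Bool) (hD : I.origin k ≠ D)
    (hu : C.kind (I.origin k) ≠ .utility) :
    (x (I.origin k)).2 k =
      I.sent m (I.origin k) (fun w => x w.1) (e (I.origin k)) k := by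
  rw [hx.eq_of_ne hD hu]
  exact if_pos rfl

theorem table_of_ne (hx : I.IsSolution m e x) (k : Fin I.n ⊕ Bool) {v : V} (hD : v ≠ D)
    (hu : C.kind v ≠ .utility) (hk : v ≠ I.origin k) :
    (x v).2 k = (I.input (fun w : C.parents v => x w.1) (I.via v k)).2 k := by
  rw [hx.eq_of_ne hD hu]
  exact if_neg hk

/-- The entries of the table are passed on to all descendants. -/
theorem table_eq [Finite V] (hx : I.IsSolution m e x) (k : Fin I.n ⊕ Bool) (v : V)
    (hk : C.HasDirectedPath (I.origin k) v)
    (hD : I.origin k = D ∨ C.HasDirectedPath v D ∧ v ≠ D) (hu : C.kind v ≠ .utility) :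
    (x v).2 k = (x (I.origin k)).2 k := by
  induction v using C.wellFounded_adj.induction with
  | _ v ih =>
    by_cases hv : v = I.origin k
    · rw [hv]
    -- The policy sets the whole table at `D`. The way back to the origin must therefore either end
    -- at `D` or stay among its proper ancestors.
    · have hvD : v ≠ D := by
        rcases hD with h | h
        · rwa [← h]
        · exact h.2
      obtain ⟨h1, h2⟩ := I.via_spec hk hv
      rw [hx.table_of_ne k hvD hu hv, input_of_adj h1]
      refine ih _ h1 h2 (hD.imp id fun h => ⟨.head h1 h.1, fun h' => ?_⟩) (kind_ne_utility h1)
      rw [h'] at h1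
      exact h.1.not_adj h1

theorem mask_eq [Finite V] (hx : I.IsSolution m e x) :
    I.mask m (I.q 0) (fun w => x w.1) = m := by
  have h0 : I.q 0 ≠ D := I.q_ne_decision I.n_pos
  have hX : (x X).2 (.inr false) = m := hx.table_origin (.inr false) I.ne
    (kind_ne_utility_of_path (I.path_observation.tail I.adj_decision) I.ne)
  have h1 := hx.table_eq (.inr false) (I.q 0) I.path_observation
    (Or.inr ⟨.single I.adj_decision, h0⟩) (kind_ne_utility I.adj_decision)
  by_cases h : I.q 0 = X
  · exact if_pos h
  · rw [mask, if_neg h, ← hx.table_of_ne (.inr false) h0 (kind_ne_utility I.adj_decision) h, h1]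
    exact hX

theorem bit_eq [Finite V] (hx : I.IsSolution m e x) {i : ℕ} (hi : i < I.n) :
    (x (I.q i)).1 = (if i = 0 then m else 1) *
      (I.input (fun w : C.parents (I.q i) => x w.1) (I.q (i - 1))).1 *
      (I.input (fun w : C.parents (I.q i) => x w.1) (I.q (i + 1))).1 *
      (open Classical in if C.Adj (I.q (i - 1)) (I.q i) ∨ C.Adj (I.q (i + 1)) (I.q i) then 1
        else sign (e (I.q i))) := by
  rw [hx.eq_of_ne (I.q_ne_decision hi) (I.kind_q_ne_utility hi)]
  classical
  have h : (if I.q i = I.q 0 then I.mask m (I.q i) (fun w => x w.1) else 1) =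
      if i = 0 then m else 1 := by
    rcases Nat.eq_zero_or_pos i with rfl | h0
    · rw [if_pos rfl, if_pos rfl, hx.mask_eq]
    · rw [if_neg (I.q_ne_zero h0 hi.le), if_neg h0.ne']
  simp only [pathBit, if_pos (⟨i, hi.le, rfl⟩ : ∃ j ≤ I.n, I.q j = I.q i), I.pos_q hi.le]
  rw [← h]

theorem bit_collider [Finite V] (hx : I.IsSolution m e x) {i : ℕ} (hi : i < I.n)
    (hc : I.IsCollider i) :
    (x (I.q i)).1 = (x (I.q (i - 1))).1 * (x (I.q (i + 1))).1 := by
  have h0 : i ≠ 0 := fun h => I.not_isCollider_zero (h ▸ hc)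
  rw [hx.bit_eq hi, input_of_adj hc.1, input_of_adj hc.2, if_pos (Or.inl hc.1), if_neg h0,
    one_mul, mul_one]

theorem bit_left [Finite V] (hx : I.IsSolution m e x) {i : ℕ} (hi : i < I.n)
    (hl : C.Adj (I.q (i - 1)) (I.q i)) (hr : ¬ C.Adj (I.q (i + 1)) (I.q i)) :
    (x (I.q i)).1 = (x (I.q (i - 1))).1 := by
  have h0 : i ≠ 0 := by
    rintro rfl
    exact DAG.Adj.ne hl rfl
  rw [hx.bit_eq hi, input_of_adj hl, input_of_not_adj hr, if_pos (Or.inl hl), if_neg h0,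
    one_mul, mul_one, mul_one]

theorem bit_right [Finite V] (hx : I.IsSolution m e x) {i : ℕ} (hi : i < I.n)
    (hl : ¬ C.Adj (I.q (i - 1)) (I.q i)) (hr : C.Adj (I.q (i + 1)) (I.q i)) :
    (x (I.q i)).1 = (if i = 0 then m else 1) * (x (I.q (i + 1))).1 := by
  rw [hx.bit_eq hi, input_of_not_adj hl, input_of_adj hr, if_pos (Or.inr hr), mul_one, mul_one]

theorem bit_source [Finite V] (hx : I.IsSolution m e x) {i : ℕ} (hi : i < I.n)
    (hl : ¬ C.Adj (I.q (i - 1)) (I.q i)) (hr : ¬ C.Adj (I.q (i + 1)) (I.q i)) :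
    (x (I.q i)).1 = (if i = 0 then m else 1) * sign (e (I.q i)) := by
  rw [hx.bit_eq hi, input_of_not_adj hl, input_of_not_adj hr, if_neg (not_or_intro hl hr),
    mul_one, mul_one]

/-- Both neighbours of a collider are non-colliders, so the two changes of sign cancel in the
product. -/
theorem bit_collider_of_flip [Finite V] (hx : I.IsSolution m e x) {e' : V → Bool}
    {y : V → I.Message} (hy : I.IsSolution m e' y) {i : ℕ} (hi : i < I.n) (hc : I.IsCollider i)
    (ih : ∀ j < I.n, C.Adj (I.q j) (I.q i) → ¬ I.IsCollider j →
      (x (I.q j)).1 = -(y (I.q j)).1) :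
    (x (I.q i)).1 = (y (I.q i)).1 := by
  rw [hx.bit_collider hi hc, hy.bit_collider hi hc,
    ih _ (by omega) hc.1 (I.not_isCollider_of_adj_left hc.1),
    ih _ (I.succ_lt_of_adj hi hc.2) hc.2 (I.not_isCollider_of_adj_right hc.2), neg_mul_neg]

/-- If all exogenous bits except that of `D` change, then the bits of the path change except at the
colliders. -/
theorem bit_flip [Finite V] (hx : I.IsSolution m e x) {e' : V → Bool} {y : V → I.Message}
    (hy : I.IsSolution m e' y) (he : ∀ v, v ≠ D → e v = !e' v) {i : ℕ} (hi : i < I.n)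
    (hc : ¬ I.IsCollider i) : (x (I.q i)).1 = -(y (I.q i)).1 := by
  generalize hv : I.q i = v
  -- The induction follows the edges of the graph, since bits may flow in either direction along the
  -- path.
  induction v using C.wellFounded_adj.induction generalizing i with
  | _ v ih =>
    subst hv
    by_cases hl : C.Adj (I.q (i - 1)) (I.q i)
    · have hr : ¬ C.Adj (I.q (i + 1)) (I.q i) := fun hr => hc ⟨hl, hr⟩
      rw [hx.bit_left hi hl hr, hy.bit_left hi hl hr]
      exact ih _ hl (by omega) (I.not_isCollider_of_adj_left hl) rfl
    · by_cases hr : C.Adj (I.q (i + 1)) (I.q i)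
      · rw [hx.bit_right hi hl hr, hy.bit_right hi hl hr,
          ih _ hr (I.succ_lt_of_adj hi hr) (I.not_isCollider_of_adj_right hr) rfl, mul_neg]
      · rw [hx.bit_source hi hl hr, hy.bit_source hi hl hr, he _ (I.q_ne_decision hi), ← mul_neg]
        congr 1
        cases e' (I.q i) <;> decide

theorem bit_collider_eq [Finite V] (hx : I.IsSolution m e x) {e' : V → Bool} {y : V → I.Message}
    (hy : I.IsSolution m e' y) (he : ∀ v, v ≠ D → e v = !e' v) {i : ℕ} (hi : i < I.n)
    (hc : I.IsCollider i) : (x (I.q i)).1 = (y (I.q i)).1 :=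
  hx.bit_collider_of_flip hy hi hc fun _ hj _ hcj => hx.bit_flip hy he hj hcj

theorem bit_zero_of_masked [Finite V] (hx : I.IsSolution 0 e x) : (x (I.q 0)).1 = 0 := by
  rw [hx.bit_eq I.n_pos, if_pos rfl, zero_mul, zero_mul, zero_mul]

/-- In the masked model the parents of `D` do not depend on the exogenous bits. -/
theorem table_eq_of_masked [Finite V] (hx : I.IsSolution 0 e x) {e' : V → Bool}
    {y : V → I.Message} (hy : I.IsSolution 0 e' y) (he : ∀ v, v ≠ D → e v = !e' v)
    (k : Fin I.n ⊕ Bool) {v : V} (hv : C.HasDirectedPath v D) (hvD : v ≠ D) :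
    (x v).2 k = (y v).2 k := by
  induction v using C.wellFounded_adj.induction with
  | _ v ih =>
    have hu := kind_ne_utility_of_path hv hvD
    by_cases hk : v = I.origin k
    · subst hk
      rw [hx.table_origin k hvD hu, hy.table_origin k hvD hu]
      rcases k with i | _ | _
      · by_cases hc : I.IsCollider i
        · simp only [sent, if_pos hc]
          rw [hx.pathBit_eq hvD hu, hy.pathBit_eq hvD hu]
          exact hx.bit_collider_eq hy he i.2 hc
        · simp only [sent, if_neg hc]
      · rfl
      · rfl
    · rw [hx.table_of_ne k hvD hu hk, hy.table_of_ne k hvD hu hk]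
      by_cases hw : C.Adj (I.via v k) v
      · rw [input_of_adj hw, input_of_adj hw]
        refine ih _ hw (.head hw hv) fun h => ?_
        rw [h] at hw
        exact hv.not_adj hw
      · rw [input_of_not_adj hw, input_of_not_adj hw]

/-- A parent of `D` on the path is `q 0`, whose bit is masked, or a collider, whose bit survives the
flip; any other would block the path. -/
theorem parents_eq_of_masked [Finite V] (hx : I.IsSolution 0 e x) {e' : V → Bool}
    {y : V → I.Message} (hy : I.IsSolution 0 e' y) (he : ∀ v, v ≠ D → e v = !e' v) {v : V}
    (hv : C.Adj v D) : x v = y v := by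
  refine Prod.ext ?_ (funext fun k =>
    hx.table_eq_of_masked hy he k (.single hv) (DAG.Adj.ne hv))
  by_cases hp : ∃ i ≤ I.n, I.q i = v
  · obtain ⟨i, hi, rfl⟩ := hp
    have hin : i < I.n := lt_of_le_of_ne hi fun h => kind_ne_utility hv (h ▸ I.kind_last)
    rcases Nat.eq_zero_or_pos i with rfl | h0
    · rw [hx.bit_zero_of_masked, hy.bit_zero_of_masked]
    · by_cases hc : I.IsCollider i
      · exact hx.bit_collider_eq hy he hin hc
      · exact absurd (Or.inr hv) (I.not_mem_family h0 hin hc)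
  · rw [hx.eq_of_ne (DAG.Adj.ne hv) (kind_ne_utility hv),
      hy.eq_of_ne (DAG.Adj.ne hv) (kind_ne_utility hv)]
    simp only [pathBit, if_neg hp]

/-- Without the mask the bits of the path do not vanish. -/
theorem bit_ne_zero [Finite V] (hx : I.IsSolution 1 e x) {i : ℕ} (hi : i < I.n) :
    (x (I.q i)).1 ≠ 0 := by
  generalize hv : I.q i = v
  induction v using C.wellFounded_adj.induction generalizing i with
  | _ v ih =>
    subst hv
    by_cases hl : C.Adj (I.q (i - 1)) (I.q i)
    · by_cases hr : C.Adj (I.q (i + 1)) (I.q i)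
      · rw [hx.bit_collider hi ⟨hl, hr⟩]
        exact mul_ne_zero (ih _ hl (by omega) rfl) (ih _ hr (I.succ_lt_of_adj hi hr) rfl)
      · rw [hx.bit_left hi hl hr]
        exact ih _ hl (by omega) rfl
    · by_cases hr : C.Adj (I.q (i + 1)) (I.q i)
      · rw [hx.bit_right hi hl hr, ite_self, one_mul]
        exact ih _ hr (I.succ_lt_of_adj hi hr) rfl
      · rw [hx.bit_source hi hl hr, ite_self, one_mul]
        cases e (I.q i) <;> decide

open Classical in
/-- The bit of the tail of the edge between `q i` and `q (i + 1)` is the product of the bits of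
`q 0` and of the colliders up to `q i`. -/
theorem tail_eq_prod [Finite V] (hx : I.IsSolution 1 e x) (i : ℕ) (hi : i < I.n) :
    (if C.Adj (I.q i) (I.q (i + 1)) then (x (I.q i)).1 else (x (I.q (i + 1))).1) =
      (x (I.q 0)).1 *
        ∏ j ∈ Finset.range (i + 1), if I.IsCollider j then (x (I.q j)).1 else 1 := by
  induction i with
  | zero =>
    simp only [Finset.range_one, Finset.prod_singleton, zero_add,
      if_neg I.not_isCollider_zero, mul_one]
    split_ifs with h
    · rfl
    · have hr := (I.active.adj 0 hi).resolve_left h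
      rw [hx.bit_right hi (fun h => DAG.Adj.ne h rfl) hr, ite_self, one_mul]
  | succ i ih =>
    rw [Finset.prod_range_succ, ← mul_assoc, ← ih (by omega)]
    rcases I.active.adj i (by omega) with hl | hl
    · rcases I.active.adj (i + 1) hi with hr | hr
      · have hc : ¬ I.IsCollider (i + 1) := fun hc => DAG.Adj.asymm hr hc.2
        rw [if_pos hl, if_pos hr, if_neg hc, mul_one]
        exact hx.bit_left hi hl (DAG.Adj.asymm hr)
      · have hc : I.IsCollider (i + 1) := ⟨hl, hr⟩
        rw [if_pos hl, if_neg (DAG.Adj.asymm hr), if_pos hc, hx.bit_collider hi hc,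
          Nat.add_sub_cancel, ← mul_assoc]
        -- The collider's bit is the product of both neighbours' bits. A nonzero sign squares to
        -- `1`, so multiplying by the left one leaves the right one.
        have h0 := hx.bit_ne_zero (show i < I.n by omega)
        generalize (x (I.q i)).1 = a at h0 ⊢
        have : a * a = 1 := by
          revert h0
          cases a <;> decide
        rw [this, one_mul]
    · have hc : ¬ I.IsCollider (i + 1) := fun hc => DAG.Adj.asymm hl hc.1
      rw [if_neg (DAG.Adj.asymm hl), if_neg hc, mul_one]
      split_ifs with hr
      · rfl
      · have hr' := (I.active.adj (i + 1) hi).resolve_left hr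
        rw [hx.bit_right hi (DAG.Adj.asymm hl) hr', ite_self, one_mul]

open Classical in
theorem last_eq_prod [Finite V] (hx : I.IsSolution 1 e x) :
    (x (I.q (I.n - 1))).1 =
      (x (I.q 0)).1 * ∏ j ∈ Finset.range I.n, if I.IsCollider j then (x (I.q j)).1 else 1 := by
  have hn := I.n_pos
  have h := hx.tail_eq_prod (I.n - 1) (by omega)
  rw [Nat.sub_add_cancel hn] at h
  rwa [if_pos I.adj_last] at h

/-- The utility node `q n` compares the decision with the last bit of the path. -/
theorem last_eq [Finite V] (hx : I.IsSolution m e x) :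
    x (I.q I.n) = open Classical in
      if (x (I.q (I.n - 1))).1 = (x D).2 (.inr true) then I.good else I.bad := by
  have hvia := I.via_spec (k := .inr true) I.path_utility I.last_ne_decision
  rw [hx _ I.last_ne_decision, structural, if_pos I.kind_last, input_of_adj I.adj_last,
    input_of_adj hvia.1, hx.table_eq (.inr true) _ hvia.2 (Or.inl rfl) (kind_ne_utility hvia.1)]
  simp only [true_and]
  rfl

/-- All utility nodes other than `q n` are constant. -/
theorem eq_bad (hx : I.IsSolution m e x) {u : V} (hu : C.kind u = .utility) (hne : u ≠ I.q I.n) :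
    x u = I.bad := by
  have huD : u ≠ D := by
    rintro rfl
    rw [I.kind_decision] at hu
    cases hu
  rw [hx u huD, structural, if_pos hu, if_neg fun h => hne h.1]

end IsSolution

/-! ### Decoding the last bit -/

open Classical in
/-- The decision that matches the last bit of the path, computed from the parents of `D`. -/
noncomputable def decode (pa : C.parents D → I.Message) : SignType :=
  (I.input pa (I.q 0)).1 *
    ∏ j : Fin I.n, if I.IsCollider j then (I.input pa (I.via D (.inl j))).2 (.inl j) else 1

/-- Every collider is an ancestor of `D`, so its bit reaches a parent of `D` through the table. -/
theorem IsSolution.decode_eq [Finite V] (hx : I.IsSolution 1 e x) :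
    I.decode (fun w => x w.1) = (x (I.q (I.n - 1))).1 := by
  classical
  rw [hx.last_eq_prod, decode, input_of_adj I.adj_decision, ← Fin.prod_univ_eq_prod_range
    (fun j => if I.IsCollider j then (x (I.q j)).1 else 1)]
  congr 1
  refine Finset.prod_congr rfl fun j _ => ?_
  split_ifs with hc
  · obtain ⟨h1, h2⟩ := I.via_spec (k := .inl j) (hc.path j.2) (I.q_ne_decision j.2).symm
    rw [input_of_adj h1, hx.table_eq (.inl j) _ h2 (Or.inr ⟨.single h1, DAG.Adj.ne h1⟩)
      (kind_ne_utility h1), hx.table_origin (.inl j) (I.q_ne_decision j.2)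
      (I.kind_q_ne_utility j.2)]
    simp only [sent, if_pos hc]
    exact hx.pathBit_eq (I.q_ne_decision j.2) (I.kind_q_ne_utility j.2)
  · rfl

/-- The parameter `m` enters only at `X`, so changing it amounts to an intervention on `X`. -/
theorem structural_of_ne (m m' : SignType) {v : V} (hv : v ≠ X) :
    I.structural m v = I.structural m' v := by
  have hbit : I.pathBit m v = I.pathBit m' v := by
    funext pa ε
    rw [pathBit, pathBit, mask, mask, if_neg hv, if_neg hv]
  have htable : I.table m v = I.table m' v := by
    funext pa ε k
    by_cases hk : v = I.origin k
    · rw [table, table, if_pos hk, if_pos hk]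
      rcases k with i | _ | _
      · simp only [sent, hbit]
      · exact absurd hk hv
      · rfl
    · rw [table, table, if_neg hk, if_neg hk]
  funext pa ε
  rw [structural, structural, hbit, htable]

/-! ### Optimal policies and the masking intervention -/

section Model

variable [Fintype V] [DecidableEq V] (hD : C.IsSingleDecision D)

theorem isSolution_val (m : SignType) (π : (I.model m).Policy D) (e : V → Bool) :
    I.IsSolution m e ((I.model m).val hD π e) := fun _ hv => (I.model m).val_of_ne hD π e hv

theorem totalUtility_model (π : (I.model 1).Policy D) (e : V → Bool) :
    (I.model 1).totalUtility hD π e =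
      ∑ u : {u : V // C.kind u = NodeKind.utility}, I.utility ((I.model 1).val hD π e u.1) := rfl

theorem totalUtility_eq_of_match (π : (I.model 1).Policy D) (e : V → Bool)
    (h : ((I.model 1).val hD π e (I.q (I.n - 1))).1 = ((I.model 1).val hD π e D).2 (.inr true)) :
    (I.model 1).totalUtility hD π e =
      ∑ u : {u : V // C.kind u = NodeKind.utility},
        I.utility (if u.1 = I.q I.n then I.good else I.bad) := by
  rw [totalUtility_model]
  refine Finset.sum_congr rfl fun u _ => ?_
  have hx := I.isSolution_val hD 1 π e
  split_ifs with hu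
  · rw [hu, hx.last_eq, if_pos h]
  · rw [hx.eq_bad u.2 hu]

theorem totalUtility_lt_of_not_match (π : (I.model 1).Policy D) (e : V → Bool)
    (h : ((I.model 1).val hD π e (I.q (I.n - 1))).1 ≠ ((I.model 1).val hD π e D).2 (.inr true)) :
    (I.model 1).totalUtility hD π e <
      ∑ u : {u : V // C.kind u = NodeKind.utility},
        I.utility (if u.1 = I.q I.n then I.good else I.bad) := by
  rw [totalUtility_model]
  have hx := I.isSolution_val hD 1 π e
  refine Finset.sum_lt_sum (fun u _ => ?_) ⟨⟨I.q I.n, I.kind_last⟩, Finset.mem_univ _, ?_⟩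
  · split_ifs with hu
    · rw [hu, hx.last_eq, if_neg h]
      exact I.utility_bad_lt.le
    · rw [hx.eq_bad u.2 hu]
  · rw [if_pos rfl, hx.last_eq, if_neg h]
    exact I.utility_bad_lt

/-- An optimal policy always matches the last bit of the path. -/
theorem match_of_isOptimal {π : (I.model 1).Policy D} (hπ : (I.model 1).IsOptimal hD π)
    (e : V → Bool) :
    ((I.model 1).val hD π e (I.q (I.n - 1))).1 = ((I.model 1).val hD π e D).2 (.inr true) := by
  by_contra hne
  -- This policy always matches. Every setting has positive probability, so one mismatch of `π`
  -- would make `π` strictly worse.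
  obtain ⟨ρ, hρ⟩ : ∃ ρ : (I.model 1).Policy D, ∀ pa ε, ρ pa ε = (1, fun _ => I.decode pa) :=
    ⟨fun pa _ => (1, fun _ => I.decode pa), fun _ _ => rfl⟩
  have hmatch : ∀ e : V → Bool, ((I.model 1).val hD ρ e (I.q (I.n - 1))).1 =
      ((I.model 1).val hD ρ e D).2 (.inr true) := by
    intro e
    rw [(I.model 1).val_decision hD ρ e, hρ]
    exact (I.isSolution_val hD 1 ρ e).decode_eq.symm
  refine (hπ ρ).not_gt (Finset.sum_lt_sum (fun e _ => ?_) ⟨e, Finset.mem_univ _, ?_⟩)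
  · refine mul_le_mul_of_nonneg_left ?_ ENNReal.toReal_nonneg
    rw [I.totalUtility_eq_of_match hD ρ e (hmatch e)]
    by_cases h : ((I.model 1).val hD π e (I.q (I.n - 1))).1 =
        ((I.model 1).val hD π e D).2 (.inr true)
    · exact (I.totalUtility_eq_of_match hD π e h).le
    · exact (I.totalUtility_lt_of_not_match hD π e h).le
  · refine mul_lt_mul_of_pos_left ?_ (ENNReal.toReal_pos ?_ (PMF.apply_ne_top _ _))
    · rw [I.totalUtility_eq_of_match hD ρ e (hmatch e)]
      exact I.totalUtility_lt_of_not_match hD π e hne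
    · exact ((PMF.mem_support_iff _ _).1 (PMF.mem_support_uniformOfFintype e))

/-- Intervening on `X` with its value in the masked model gives the masked model. -/
theorem potentialResponse_eq_val (π : (I.model 1).Policy D) (e : V → Bool) (v : V) :
    ((I.model 1).withPolicy hD π).potentialResponse X ((I.model 0).val hD π e X) e v =
      (I.model 0).val hD π e v := by
  symm
  refine SCM.eq_eval (((I.model 1).withPolicy hD π).intervene X ((I.model 0).val hD π e X)) e
    ((I.model 0).val hD π e) (fun v => ?_) v
  by_cases hv : v = X
  · subst hv
    exact (congrFun (congrFun (SCM.intervene_f_self ((I.model 1).withPolicy hD π) _ _) _) _).symm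
  · rw [SCM.intervene_f_of_ne ((I.model 1).withPolicy hD π) _ _ _ hv]
    by_cases hvD : v = D
    · subst hvD
      rw [SCIM.withPolicy_f_decision]
      exact (I.model 0).val_decision hD π e
    · rw [SCIM.withPolicy_f_of_ne _ hD π v (SCIM.kind_ne_decision hD hvD)]
      rw [(I.model 0).val_of_ne hD π e hvD]
      exact congrFun (congrFun (I.structural_of_ne 0 1 hv) _) _

theorem hasResponseIncentive : (I.model 1).HasResponseIncentive hD X := by
  intro π hπ
  by_contra! hno
  have h : ∀ e : V → Bool, (I.model 0).val hD π e D = (I.model 1).val hD π e D := fun e => by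
    rw [← I.potentialResponse_eq_val hD π e D]
    exact hno _ e
  -- Two settings opposite everywhere except at `D`, so that the policy receives the same noise in
  -- both.
  have he : ∀ v, v ≠ D → (fun _ => false : V → Bool) v = !(fun v => decide (v ≠ D)) v := by
    intro v hv
    simp [hv]
  have h0 : (I.model 0).val hD π (fun _ => false) D =
      (I.model 0).val hD π (fun v => decide (v ≠ D)) D := by
    rw [(I.model 0).val_decision hD π, (I.model 0).val_decision hD π]
    refine congr (congrArg π (funext fun w => ?_)) (by simp)
    exact (I.isSolution_val hD 0 π _).parents_eq_of_masked (I.isSolution_val hD 0 π _) he w.2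
  rw [h, h] at h0
  have hlt : I.n - 1 < I.n := Nat.sub_lt I.n_pos one_pos
  -- The decision equals the last bit at both settings, yet that bit is nonzero and changes sign
  -- between them.
  have h1 := (I.isSolution_val hD 1 π _).bit_flip (I.isSolution_val hD 1 π _) he hlt
    (I.not_isCollider_of_adj_left I.adj_last)
  have h2 := (I.isSolution_val hD 1 π (fun _ => false)).bit_ne_zero hlt
  rw [I.match_of_isOptimal hD hπ, I.match_of_isOptimal hD hπ, h0] at h1
  rw [I.match_of_isOptimal hD hπ, h0] at h2
  generalize ((I.model 1).val hD π (fun v => decide (v ≠ D)) D).2 (.inr true) = a at h1 h2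
  revert h1 h2
  cases a <;> decide

end Model

end CID.IncentivePath

theorem mainTheorem1 {V : Type*} [Fintype V] [DecidableEq V] (C : CID V) (D : V)
    (hD : C.IsSingleDecision D) (X : V) (hX : X ≠ D) :
    C.CompatibleWithResponseIncentive hD X ↔
      ∃ W U : V, W ∈ C.parents D ∧ C.kind U = NodeKind.utility ∧
        C.HasDirectedPath X W ∧
        C.HasDirectedPath D U ∧
        C.DConn {W} {U} (C.family D \ {W}) := by
  refine ⟨fun h => h.exists_dConn hX, ?_⟩
  rintro ⟨W, U, hW, hU, hXW, hDU, hc⟩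
  obtain ⟨n, q, rfl, rfl, hact, hinj⟩ := DAG.dConn_singleton_iff.1 hc
  let I : C.IncentivePath D X := ⟨n, q, hX, (hD D).2 rfl, hW, hU, hXW, hDU, hact, hinj⟩
  exact ⟨I.model 1, I.hasResponseIncentive hD⟩
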